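/- Let $\mathbb D$ be the open unit disk in $\mathbb C$. For a complex function $f$ write $f_z=\frac12(f_x-if_y)$, $f_{\bar z}=\frac12(f_x+if_y)$, $\|D_f\|=|f_z|+|f_{\bar z}|$, $J_f=|f_z|^2-|f_{\bar z}|^2$, and let $$P[f](z)=\frac1{2\pi}\int_0^{2\pi}\frac{1-|z|^2}{|1-ze^{-it}|^2}f(e^{it})\,dt,\qquad G[g](z)=\frac1{2\pi}\int_{\mathbb D}\log\left|\frac{1-z\overline w}{z-w}\right|g(w)\,dA(w).$$ For $f\in C^1(\mathbb D)$ let $\ell_f(r)=r\int_0^{2\pi}|f_z(re^{i\theta})-e^{-2i\theta}f_{\bar z}(re^{i\theta})|\,d\theta$ for $0<r<1$ and $\ell_f(1)=\sup_{0<r<1}\ell_f(r)$. A $K$-quasiconformal mapping ($K\ge 1$) is a sense-preserving homeomorphism $f$ of class $W^{1,2}_{loc}$ onto a plane domain with $\|D_f\|^2\le K|J_f|$. Let $g:\overline{\mathbb D}\to\mathbb C$ be continuous, $\|g\|_\infty=\sup_{\overline{\mathbb D}}|g|$, and let $f\in C(\overline{\mathbb D})\cap C^2(\mathbb D)$ satisfy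 $\Delta f=g$ in $\mathbb D$. If $f=P[f]-G[g]$ is a $K$-quasiconformal mapping of $\mathbb D$ with $\ell_f(1)<\infty$, then the harmonic function $P[f]$ has an expansion $P[f](z)=\sum_{n\ge0}a_nz^n+\sum_{n\ge1}\overline{b_n}\,\overline z^n$ in $\mathbb D$, and: (i) for every $n\ge1$, $$|a_n|+|b_n|\le\frac{K\ell_f(1)}{2n\pi}+\frac{2}{3n}\|g\|_\infty;$$ (ii) $$\sup_{z\in\mathbb D}\|D_{P[f]}(z)\|(1-|z|^2)\le\left(\frac{\ell_f^2(1)K}{4\pi^2}+\frac49\|g\|_\infty^2+\frac{\ell_f(1)K^{1/2}}{3\pi}\|g\|_\infty\right)^{1/2};$$ (iii) $f\in\mathcal B^1_\omega$ with $\omega(t)=t$, that is, $\sup_{z\in\mathbb D}\|D_f(z)\|\,d(z)<\infty$, where $d(z)$ is the distance from $z$ to $\partial\mathbb D$. For $K=1$ and $g=0$ the estimates (i) and (ii) are sharp, with extremal function $f(z)=z$: this function satisfies all the hypotheses with $K=1$, $g=0$, and gives equality in (i) for $n=1$ and in (ii). -/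

import Mathlib

open Complex MeasureTheory Set Filter Topology ComplexConjugate

noncomputable section

namespace PoissonDisk

/-- The open unit disk `𝔻` in the complex plane. -/
def disk : Set ℂ := Metric.ball (0 : ℂ) 1

/-- The closed unit disk. -/
def closedDisk : Set ℂ := Metric.closedBall (0 : ℂ) 1

/-- The formal derivative `f_z = (f_x - i f_y) / 2`. -/
def dz (f : ℂ → ℂ) (z : ℂ) : ℂ :=
  (fderiv ℝ f z 1 - I * fderiv ℝ f z I) / 2

/-- The formal derivative `f_z̄ = (f_x + i f_y) / 2`. -/
def dzbar (f : ℂ → ℂ) (z : ℂ) : ℂ :=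
  (fderiv ℝ f z 1 + I * fderiv ℝ f z I) / 2

/-- The operator norm `‖D_f(z)‖ = |f_z(z)| + |f_z̄(z)|` of the Jacobian matrix of `f` at `z`. -/
def normD (f : ℂ → ℂ) (z : ℂ) : ℝ := ‖dz f z‖ + ‖dzbar f z‖

/-- The Jacobian `J_f = det D_f = |f_z|² - |f_z̄|²`. -/
def jacobian (f : ℂ → ℂ) (z : ℂ) : ℝ := ‖dz f z‖ ^ 2 - ‖dzbar f z‖ ^ 2

/-- The Green function `G(z, w) = log |(1 - z w̄) / (z - w)|` of the unit disk. -/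
def greenFunction (z w : ℂ) : ℝ := Real.log ‖(1 - z * conj w) / (z - w)‖

/-- The Green potential `G[g](z) = (1 / 2π) ∫_𝔻 G(z, w) g(w) dA(w)`. -/
def greenPotential (g : ℂ → ℂ) (z : ℂ) : ℂ :=
  (1 / (2 * Real.pi) : ℂ) * ∫ w in disk, (greenFunction z w : ℂ) * g w

/-- The Poisson kernel `P(z, e^{iθ}) = (1 - |z|²) / |1 - z e^{-iθ}|²`. -/
def poissonKernelDisk (z : ℂ) (θ : ℝ) : ℝ :=
  (1 - ‖z‖ ^ 2) / ‖1 - z * exp (-(θ * I))‖ ^ 2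

/-- The Poisson integral `P[ψ](z) = (1 / 2π) ∫₀^{2π} P(z, e^{it}) ψ(e^{it}) dt`. -/
def poissonIntegral (ψ : ℂ → ℂ) (z : ℂ) : ℂ :=
  (1 / (2 * Real.pi) : ℂ) *
    ∫ t in (0 : ℝ)..(2 * Real.pi), (poissonKernelDisk z t : ℂ) * ψ (exp (t * I))

/-- The class `𝓕_g(𝔻)` of functions which are continuous on the closed unit disk, twice
continuously differentiable in the open disk, and satisfy `Δ f = g` there. -/
structure IsPoissonSolution (g f : ℂ → ℂ) : Prop where
  continuousOn : ContinuousOn f closedDisk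
  contDiffOn : ContDiffOn ℝ 2 f disk
  laplacian_eq : ∀ z ∈ disk, Laplacian.laplacian f z = g z

/-- The supremum `‖g‖_∞` of `|g|` over the closed unit disk (for `g` continuous there). -/
def supNorm (g : ℂ → ℂ) : ℝ := sSup ((fun z => ‖g z‖) '' closedDisk)

/-- `f` preserves the orientation of `Ω`: around every point `z` of `Ω`, as `ζ` runs once
counterclockwise through a small circle centred at `z`, the point `f ζ` winds exactly once
counterclockwise around `f z` (`h` is a continuous branch of `log (f ζ - f z)` along the circle). -/
def SensePreservingOn (f : ℂ → ℂ) (Ω : Set ℂ) : Prop :=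
  ∀ z ∈ Ω, ∀ᶠ r : ℝ in 𝓝[>] 0, ∃ h : ℝ → ℂ, Continuous h ∧
    (∀ t : ℝ, f (z + r * exp (t * I)) - f z = exp (h t)) ∧
    h (2 * Real.pi) - h 0 = 2 * Real.pi * I

/-- A continuously differentiable `K`-quasiconformal mapping of the open set `Ω`:
a sense-preserving homeomorphism of `Ω` onto an open subset of the plane with
`‖D_f‖² ≤ K |det D_f|` in `Ω`. (Continuously differentiable functions belong to the Sobolev
space `W^{1,2}_loc(Ω)` and their weak derivatives are the classical ones.) -/
structure IsQuasiconformalOn (K : ℝ) (f : ℂ → ℂ) (Ω : Set ℂ) : Prop where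
  one_le : 1 ≤ K
  contDiffOn : ContDiffOn ℝ 1 f Ω
  isOpenEmbedding : IsOpenEmbedding (Ω.domRestrict f)
  sensePreserving : SensePreservingOn f Ω
  distortion : ∀ z ∈ Ω, normD f z ^ 2 ≤ K * |jacobian f z|

/-- The perimeter `ℓ_f(r)`, counting multiplicity, of the image of the circle `|z| = r`. -/
def perimeter (f : ℂ → ℂ) (r : ℝ) : ℝ :=
  r * ∫ θ in (0 : ℝ)..(2 * Real.pi),
    ‖dz f (r * exp (θ * I)) - exp (-(2 * θ * I)) * dzbar f (r * exp (θ * I))‖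

/-- The condition `ℓ_f(1) < ∞`. -/
def HasFiniteBoundaryPerimeter (f : ℂ → ℂ) : Prop := BddAbove (perimeter f '' Ioo 0 1)

/-- `ℓ_f(1) = sup_{0 < r < 1} ℓ_f(r)` (meaningful when this supremum is finite). -/
def boundaryPerimeter (f : ℂ → ℂ) : ℝ := sSup (perimeter f '' Ioo 0 1)

/-- `F(z) = ∑_{n ≥ 0} a_n zⁿ + ∑_{n ≥ 1} conj(b_n) conj(z)ⁿ` in the unit disk, both series being
convergent there. The value `b 0` plays no role. -/
def HasHarmonicExpansion (F : ℂ → ℂ) (a b : ℕ → ℂ) : Prop :=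
  ∀ z ∈ disk, ∃ s t : ℂ, HasSum (fun n : ℕ => a n * z ^ n) s ∧
    HasSum (fun n : ℕ => conj (b (n + 1)) * conj z ^ (n + 1)) t ∧ F z = s + t

/-- A majorant: a continuous increasing function `ω : [0, ∞) → [0, ∞)` with `ω 0 = 0` such that
`ω t / t` is non-increasing for `t > 0`. -/
structure IsMajorant (ω : ℝ → ℝ) : Prop where
  continuousOn : ContinuousOn ω (Ici 0)
  monotoneOn : MonotoneOn ω (Ici 0)
  map_zero : ω 0 = 0
  antitoneOn : AntitoneOn (fun t => ω t / t) (Ioi 0)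

/-- The Euclidean distance from `z` to the boundary of the unit disk. -/
def distBoundary (z : ℂ) : ℝ := Metric.infDist z (frontier disk)

/-- The class `𝓑_ω^α` of Bloch type mappings: `f ∈ C¹(𝔻)` with
`sup_{z ∈ 𝔻} ‖D_f(z)‖ ω(d(z)^α) < ∞`, for a majorant `ω` and `α > 0`. -/
structure IsBlochType (ω : ℝ → ℝ) (α : ℝ) (f : ℂ → ℂ) : Prop where
  isMajorant : IsMajorant ω
  exponent_pos : 0 < α
  contDiffOn : ContDiffOn ℝ 1 f disk
  bddAbove : BddAbove ((fun z => normD f z * ω (distBoundary z ^ α)) '' disk)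

end PoissonDisk

end

open PoissonDisk

/-! Everything is read off the Fourier coefficients `circleCoeff` of functions on circles |ζ| = s.
Two relations, from differentiating in the radius and from integrating an angular derivative over a
period, combine into Green's formula in the form d/ds (s^(m+1) c_(m+1)(u)) = 2 s^(m+1) c_m(u_z).

(i) Since f_(z z̄) = Δf/4 is bounded, Green's formula for u = f_z̄ makes c_(n+1)(f_z̄) small. The
angular relation then bounds n|c_n(f)| by s∫|f_z| plus a term in ‖g‖; the same holds for the
conjugate of f. Quasiconformality gives ‖D_f‖ ≤ K(|f_z| - |f_z̄|), which is at most K times the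
integrand of ℓ_f. Letting s → 1 turns the c_n into 2πa_n and 2πb_n.

(ii) The derivatives of P[f] at z are first coefficients of f and of its conjugate against the
antiholomorphic kernel (1 - z ζ̄)⁻². Green's formula turns them into area integrals of f_z and f_z̄
against this kernel. Weighted AM-GM separates the energy, at most K times the signed area inside the
image curve, from the explicit L² norm of the kernel. The isoperimetric inequality (Wirtinger's
inequality after reparametrization) bounds the area by ℓ²/(4π), and optimizing the weight leaves
ℓ√K/(2π), which is stronger than (ii).

(iii) This is an interior gradient estimate on discs of radius comparable to 1 - |z|.

The main steps are `hasDerivAt_pow_mul_circleCoeff_dz`, `mul_norm_boundary_circleCoeff_le`,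
`im_integral_conj_mul_deriv_le`, `norm_circleCoeff_mul_bergmanKernel_le` and
`SensePreservingOn.jacobian_nonneg`. -/

noncomputable section

namespace PoissonDisk

/-! ### Wirtinger calculus. -/

theorem fderiv_apply_eq_dz_add_dzbar (f : ℂ → ℂ) (z v : ℂ) :
    fderiv ℝ f z v = dz f z * v + dzbar f z * conj v := by
  have hv : v = v.re • (1 : ℂ) + v.im • I := by
    simp
  conv_lhs => rw [hv, map_add, map_smul, map_smul]
  have h2 : conj v = v.re - v.im * I := by
    apply Complex.ext <;> simp
  have h1 : v = v.re + v.im * I := (re_add_im v).symm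
  rw [h2]
  conv_rhs => rw [h1]
  simp only [dz, dzbar, real_smul, add_re, mul_re, I_re, I_im, ofReal_re, ofReal_im, add_im, mul_im]
  push_cast
  linear_combination ((v.im : ℂ) * fderiv ℝ f z I) * I_sq

theorem dz_of_hasFDerivAt {f : ℂ → ℂ} {z : ℂ} {L : ℂ →L[ℝ] ℂ} (h : HasFDerivAt f L z) :
    dz f z = (L 1 - I * L I) / 2 := by rw [dz, h.fderiv]

theorem dzbar_of_hasFDerivAt {f : ℂ → ℂ} {z : ℂ} {L : ℂ →L[ℝ] ℂ} (h : HasFDerivAt f L z) :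
    dzbar f z = (L 1 + I * L I) / 2 := by rw [dzbar, h.fderiv]

theorem dz_conj_comp (f : ℂ → ℂ) (z : ℂ) :
    dz (fun w => conj (f w)) z = conj (dzbar f z) := by
  have h : fderiv ℝ (fun w => conj (f w)) z
      = (conjCLE : ℂ →L[ℝ] ℂ).comp (fderiv ℝ f z) := conjCLE.comp_fderiv (f := f) (x := z)
  simp [dz, dzbar, h, map_ofNat]
  ring

theorem dzbar_conj_comp (f : ℂ → ℂ) (z : ℂ) :
    dzbar (fun w => conj (f w)) z = conj (dz f z) := by
  have h : fderiv ℝ (fun w => conj (f w)) z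
      = (conjCLE : ℂ →L[ℝ] ℂ).comp (fderiv ℝ f z) := conjCLE.comp_fderiv (f := f) (x := z)
  simp [dz, dzbar, h, map_ofNat]

theorem dz_mul {f g : ℂ → ℂ} {z : ℂ} (hf : DifferentiableAt ℝ f z) (hg : DifferentiableAt ℝ g z) :
    dz (fun w => f w * g w) z = dz f z * g z + f z * dz g z := by
  have h := hf.hasFDerivAt.mul hg.hasFDerivAt
  rw [dz_of_hasFDerivAt (f := fun w => f w * g w) h]
  simp [dz]
  ring

theorem dz_of_hasDerivAt {f : ℂ → ℂ} {f' z : ℂ} (h : HasDerivAt f f' z) : dz f z = f' := by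
  rw [dz_of_hasFDerivAt (h.hasFDerivAt.restrictScalars ℝ)]
  simp
  linear_combination (-f' / 2) * I_sq

theorem dzbar_of_hasDerivAt {f : ℂ → ℂ} {f' z : ℂ} (h : HasDerivAt f f' z) : dzbar f z = 0 := by
  rw [dzbar_of_hasFDerivAt (h.hasFDerivAt.restrictScalars ℝ)]
  simp
  linear_combination f' * I_sq

theorem dz_add {f g : ℂ → ℂ} {z : ℂ} (hf : DifferentiableAt ℝ f z) (hg : DifferentiableAt ℝ g z) :
    dz (fun w => f w + g w) z = dz f z + dz g z := by
  rw [dz_of_hasFDerivAt (f := fun w => f w + g w) (hf.hasFDerivAt.add hg.hasFDerivAt)]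
  simp [dz]
  ring

theorem dzbar_add {f g : ℂ → ℂ} {z : ℂ} (hf : DifferentiableAt ℝ f z)
    (hg : DifferentiableAt ℝ g z) :
    dzbar (fun w => f w + g w) z = dzbar f z + dzbar g z := by
  rw [dzbar_of_hasFDerivAt (f := fun w => f w + g w) (hf.hasFDerivAt.add hg.hasFDerivAt)]
  simp [dzbar]
  ring

theorem contDiffOn_dz {f : ℂ → ℂ} {U : Set ℂ} (hU : IsOpen U) (hf : ContDiffOn ℝ 2 f U) :
    ContDiffOn ℝ 1 (dz f) U := by
  have h : ContDiffOn ℝ 1 (fderiv ℝ f) U :=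
    hf.fderiv_of_isOpen hU (by norm_num)
  unfold dz
  exact ((h.clm_apply contDiffOn_const).sub
    (contDiffOn_const.mul (h.clm_apply contDiffOn_const))).div_const _

theorem contDiffOn_dzbar {f : ℂ → ℂ} {U : Set ℂ} (hU : IsOpen U) (hf : ContDiffOn ℝ 2 f U) :
    ContDiffOn ℝ 1 (dzbar f) U := by
  have h : ContDiffOn ℝ 1 (fderiv ℝ f) U :=
    hf.fderiv_of_isOpen hU (by norm_num)
  unfold dzbar
  exact ((h.clm_apply contDiffOn_const).add
    (contDiffOn_const.mul (h.clm_apply contDiffOn_const))).div_const _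

theorem continuousOn_dz {f : ℂ → ℂ} {U : Set ℂ} (hU : IsOpen U) (hf : ContDiffOn ℝ 1 f U) :
    ContinuousOn (dz f) U := by
  have h : ContinuousOn (fderiv ℝ f) U := hf.continuousOn_fderiv_of_isOpen hU le_rfl
  unfold dz
  exact ((h.clm_apply continuousOn_const).sub
    (continuousOn_const.mul (h.clm_apply continuousOn_const))).div_const _

theorem continuousOn_dzbar {f : ℂ → ℂ} {U : Set ℂ} (hU : IsOpen U) (hf : ContDiffOn ℝ 1 f U) :
    ContinuousOn (dzbar f) U := by
  have h : ContinuousOn (fderiv ℝ f) U := hf.continuousOn_fderiv_of_isOpen hU le_rfl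
  unfold dzbar
  exact ((h.clm_apply continuousOn_const).add
    (continuousOn_const.mul (h.clm_apply continuousOn_const))).div_const _

/-- `4 f_{z z̄} = Δ f`. -/
theorem dzbar_dz {f : ℂ → ℂ} {z : ℂ} (hf : ContDiffAt ℝ 2 f z) :
    dzbar (dz f) z = Laplacian.laplacian f z / 4 ∧
      dz (dzbar f) z = Laplacian.laplacian f z / 4 := by
  have hd : DifferentiableAt ℝ (fderiv ℝ f) z :=
    (hf.fderiv_right (m := 1) (by norm_num)).differentiableAt (by norm_num)
  have hs : fderiv ℝ (fderiv ℝ f) z 1 I = fderiv ℝ (fderiv ℝ f) z I 1 :=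
    (hf.isSymmSndFDerivAt (by simp)) 1 I
  have hd1 : ∀ v : ℂ, HasFDerivAt (fun w => fderiv ℝ f w v)
      ((ContinuousLinearMap.apply ℝ ℂ v).comp (fderiv ℝ (fderiv ℝ f) z)) z := fun v =>
    (ContinuousLinearMap.apply ℝ ℂ v).hasFDerivAt.comp z hd.hasFDerivAt
  have hmul := fun v : ℂ => (hd1 v).const_mul I
  have e1 := (((hd1 1).sub (hmul I)).mul_const (2⁻¹ : ℂ))
  have e2 := (((hd1 1).add (hmul I)).mul_const (2⁻¹ : ℂ))
  have h1 : dz f = fun w => (fderiv ℝ f w 1 - I * fderiv ℝ f w I) * 2⁻¹ := by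
    funext w; rw [dz, div_eq_mul_inv]
  have h2 : dzbar f = fun w => (fderiv ℝ f w 1 + I * fderiv ℝ f w I) * 2⁻¹ := by
    funext w; rw [dzbar, div_eq_mul_inv]
  rw [h1, h2, dzbar_of_hasFDerivAt
    (f := fun w => (fderiv ℝ f w 1 - I * fderiv ℝ f w I) * 2⁻¹) e1, dz_of_hasFDerivAt
    (f := fun w => (fderiv ℝ f w 1 + I * fderiv ℝ f w I) * 2⁻¹) e2,
    InnerProductSpace.laplacian_eq_iteratedFDeriv_complexPlane]
  simp [iteratedFDeriv_two_apply, hs]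
  constructor
  · linear_combination (-fderiv ℝ (fderiv ℝ f) z I I / 4) * I_sq
  · linear_combination (-fderiv ℝ (fderiv ℝ f) z I I / 4) * I_sq

/-- Joint continuity on a compact neighbourhood supplies the dominating constant. The field is left
general: 𝕜 = ℝ serves for radii, 𝕜 = ℂ for Cauchy transforms. -/
theorem hasDerivAt_integral_of_continuousOn {𝕜 : Type*} [RCLike 𝕜]
    {E : Type*} [NormedAddCommGroup E] [NormedSpace ℝ E] [NormedSpace 𝕜 E]
    {F F' : 𝕜 → ℝ → E} {U : Set 𝕜} (hU : IsOpen U) (hF : ∀ x ∈ U, Continuous (F x))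
    (hF' : ContinuousOn (Function.uncurry F') (U ×ˢ univ))
    (hd : ∀ x ∈ U, ∀ t, HasDerivAt (fun y => F y t) (F' x t) x) {x₀ : 𝕜} (hx₀ : x₀ ∈ U) (a b : ℝ) :
    HasDerivAt (fun x => ∫ t in a..b, F x t) (∫ t in a..b, F' x₀ t) x₀ := by
  obtain ⟨ε, hε, hεU⟩ := Metric.nhds_basis_closedBall.mem_iff.1 (hU.mem_nhds hx₀)
  have hK : IsCompact (Metric.closedBall x₀ ε ×ˢ uIcc a b) :=
    (isCompact_closedBall x₀ ε).prod isCompact_uIcc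
  obtain ⟨C, hC⟩ := hK.exists_bound_of_continuousOn (hF'.mono (prod_mono hεU (subset_univ _)))
  have hc' : Continuous (F' x₀) := by
    have : Continuous (fun t : ℝ => (x₀, t)) := by fun_prop
    exact hF'.comp_continuous this (fun t => ⟨hx₀, mem_univ t⟩)
  refine (intervalIntegral.hasDerivAt_integral_of_dominated_loc_of_deriv_le
    (bound := fun _ => C) (Metric.closedBall_mem_nhds x₀ hε) ?_ ?_ ?_ ?_ ?_ ?_).2
  · filter_upwards [hU.mem_nhds hx₀] with x hx using (hF x hx).aestronglyMeasurable
  · exact (hF x₀ hx₀).intervalIntegrable _ _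
  · exact hc'.aestronglyMeasurable
  · exact Eventually.of_forall fun t ht x hx => hC (x, t) ⟨hx, uIoc_subset_uIcc ht⟩
  · exact intervalIntegrable_const
  · exact Eventually.of_forall fun t ht x hx => hd x (hεU hx) t

/-! ### Fourier coefficients on circles as functions of the radius. -/

/-- The (unnormalized) `m`-th Fourier coefficient of `u` on the circle of centre `c`, radius `s`. -/
def circleCoeff (c : ℂ) (u : ℂ → ℂ) (m : ℤ) (s : ℝ) : ℂ :=
  ∫ t in (0 : ℝ)..(2 * Real.pi), u (c + s * exp (t * I)) * exp (-(m * (t * I)))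

theorem mem_ball_circle {c : ℂ} {R s : ℝ} (hs : |s| < R) (t : ℝ) :
    c + s * exp (t * I) ∈ Metric.ball c R := by
  simpa [Complex.norm_exp_ofReal_mul_I] using hs

theorem continuous_on_circle {c : ℂ} {R s : ℝ} {u : ℂ → ℂ} (hu : ContinuousOn u (Metric.ball c R))
    (hs : |s| < R) : Continuous fun t : ℝ => u (c + s * exp (t * I)) :=
  hu.comp_continuous (by fun_prop) fun t => mem_ball_circle hs t

theorem exp_mul_exp_neg (m : ℤ) (t : ℝ) :
    exp (t * I) * exp (-(m * (t * I))) = exp (-((m - 1 : ℤ) * (t * I))) := by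
  rw [← exp_add]; congr 1; push_cast; ring

theorem exp_neg_mul_exp_neg (m : ℤ) (t : ℝ) :
    exp (-(t * I)) * exp (-(m * (t * I))) = exp (-((m + 1 : ℤ) * (t * I))) := by
  rw [← exp_add]; congr 1; push_cast; ring

theorem conj_exp_mul_I (t : ℝ) : conj (exp (t * I)) = exp (-(t * I)) := by
  rw [← exp_conj]; simp

theorem norm_exp_neg_int (m : ℤ) (t : ℝ) : ‖exp (-(m * (t * I)))‖ = 1 := by
  rw [show -((m : ℂ) * (t * I)) = ((-(m * t) : ℝ) : ℂ) * I by push_cast; ring]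
  exact norm_exp_ofReal_mul_I _

theorem intervalIntegral_conj (f : ℝ → ℂ) (a b : ℝ) :
    ∫ t in a..b, conj (f t) = conj (∫ t in a..b, f t) :=
  by
  simp only [intervalIntegral, map_sub, integral_conj]

theorem norm_circleCoeff_le {c : ℂ} {u : ℂ → ℂ} {m : ℤ} {s M : ℝ}
    (h : ∀ t : ℝ, ‖u (c + s * exp (t * I))‖ ≤ M) : ‖circleCoeff c u m s‖ ≤ 2 * Real.pi * M := by
  have := intervalIntegral.norm_integral_le_of_norm_le_const (a := 0) (b := 2 * Real.pi) (C := M)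
    (f := fun t : ℝ => u (c + s * exp (t * I)) * exp (-(m * (t * I)))) fun t _ => by
      rw [norm_mul, norm_exp_neg_int, mul_one]; exact h t
  rw [sub_zero, abs_of_pos Real.two_pi_pos] at this
  rw [circleCoeff]
  linarith

theorem norm_circleCoeff_le_integral (c : ℂ) (u : ℂ → ℂ) (m : ℤ) (s : ℝ) :
    ‖circleCoeff c u m s‖ ≤ ∫ t in (0 : ℝ)..(2 * Real.pi), ‖u (c + s * exp (t * I))‖ := by
  refine (intervalIntegral.norm_integral_le_integral_norm Real.two_pi_pos.le).trans_eq ?_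
  refine intervalIntegral.integral_congr fun t _ => ?_
  simp only [norm_mul, norm_exp_neg_int, mul_one]

theorem circleCoeff_congr {c : ℂ} {u v : ℂ → ℂ} {m : ℤ} {s : ℝ}
    (h : ∀ t : ℝ, u (c + s * exp (t * I)) = v (c + s * exp (t * I))) :
    circleCoeff c u m s = circleCoeff c v m s :=
  intervalIntegral.integral_congr fun t _ => by simp only [h t]

section Relations

variable {c : ℂ} {R : ℝ} {u : ℂ → ℂ}

/-- The radial derivative is u_z e^(it) + u_z̄ e^(-it); each exponential shifts the frequency by
one. -/
theorem circleCoeff_hasDerivAt (hu : ContDiffOn ℝ 1 u (Metric.ball c R)) (m : ℤ) {s : ℝ}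
    (hs : |s| < R) :
    HasDerivAt (circleCoeff c u m)
      (circleCoeff c (dz u) (m - 1) s + circleCoeff c (dzbar u) (m + 1) s) s := by
  have hz := continuousOn_dz Metric.isOpen_ball hu
  have hzb := continuousOn_dzbar Metric.isOpen_ball hu
  have key := hasDerivAt_integral_of_continuousOn (𝕜 := ℝ)
    (F := fun s t => u (c + s * exp (t * I)) * exp (-(m * (t * I))))
    (F' := fun s t => dz u (c + s * exp (t * I)) * exp (-((m - 1 : ℤ) * (t * I))) +
      dzbar u (c + s * exp (t * I)) * exp (-((m + 1 : ℤ) * (t * I))))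
    (U := Ioo (-R) R) isOpen_Ioo
    (fun s hs => (continuous_on_circle hu.continuousOn (abs_lt.2 hs)).mul (by fun_prop)) ?_ ?_
    (abs_lt.1 hs) 0 (2 * Real.pi)
  · refine HasDerivAt.congr_deriv (f := circleCoeff c u m) key ?_
    rw [circleCoeff, circleCoeff, ← intervalIntegral.integral_add]
    · exact ((continuous_on_circle hz hs).mul (by fun_prop)).intervalIntegrable _ _
    · exact ((continuous_on_circle hzb hs).mul (by fun_prop)).intervalIntegrable _ _
  · have hm : MapsTo (fun p : ℝ × ℝ => c + p.1 * exp (p.2 * I)) (Ioo (-R) R ×ˢ univ)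
        (Metric.ball c R) := fun p hp => mem_ball_circle (abs_lt.2 hp.1) p.2
    have hc : ContinuousOn (fun p : ℝ × ℝ => c + p.1 * exp (p.2 * I)) (Ioo (-R) R ×ˢ univ) := by
      fun_prop
    exact ((hz.comp hc hm).mul (by fun_prop)).add ((hzb.comp hc hm).mul (by fun_prop))
  · intro s hs t
    have hd : DifferentiableAt ℝ u (c + s * exp (t * I)) :=
      (hu.contDiffAt (Metric.isOpen_ball.mem_nhds
        (mem_ball_circle (abs_lt.2 hs) t))).differentiableAt (by norm_num)
    have h1 : HasDerivAt (fun s : ℝ => c + s * exp (t * I)) (exp (t * I)) s := by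
      simpa using ((hasDerivAt_id s).ofReal_comp.mul_const (exp (t * I))).const_add c
    have h2 := (hd.hasFDerivAt.comp_hasDerivAt s h1).mul_const (exp (-(m * (t * I))))
    rw [fderiv_apply_eq_dz_add_dzbar, conj_exp_mul_I, add_mul, mul_assoc, mul_assoc,
      exp_mul_exp_neg, exp_neg_mul_exp_neg] at h2
    exact h2

theorem hasDerivAt_circle_angle {s : ℝ} (hu : ContDiffOn ℝ 1 u (Metric.ball c R))
    (hs : |s| < R) (t : ℝ) :
    HasDerivAt (fun t : ℝ => u (c + s * exp (t * I)))
      (I * s * (dz u (c + s * exp (t * I)) * exp (t * I) -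
        dzbar u (c + s * exp (t * I)) * exp (-(t * I)))) t := by
  have hd : DifferentiableAt ℝ u (c + s * exp (t * I)) :=
    (hu.contDiffAt (Metric.isOpen_ball.mem_nhds
      (mem_ball_circle hs t))).differentiableAt (by norm_num)
  have h1 : HasDerivAt (fun t : ℝ => c + s * exp (t * I)) (s * (exp (t * I) * I)) t := by
    have : HasDerivAt (fun t : ℝ => (t : ℂ) * I) I t := by
      simpa using (hasDerivAt_id t).ofReal_comp.mul_const I
    exact (this.cexp.const_mul (s : ℂ)).const_add c
  have h2 := hd.hasFDerivAt.comp_hasDerivAt t h1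
  refine h2.congr_deriv ?_
  rw [fderiv_apply_eq_dz_add_dzbar]
  simp only [map_mul, conj_exp_mul_I, conj_ofReal, conj_I]
  ring

theorem exp_two_pi_int (m : ℤ) : exp (-(m * ((2 * Real.pi : ℝ) * I))) = 1 := by
  rw [show -((m : ℂ) * ((2 * Real.pi : ℝ) * I)) = (-m : ℤ) * (2 * Real.pi * I) by
    push_cast; ring]
  exact exp_int_mul_two_pi_mul_I _

/-- The angular derivative of u e^(-imt) integrates to zero over a full period. -/
theorem mul_circleCoeff (hu : ContDiffOn ℝ 1 u (Metric.ball c R)) (m : ℤ) {s : ℝ}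
    (hs : |s| < R) :
    m * circleCoeff c u m s =
      s * (circleCoeff c (dz u) (m - 1) s - circleCoeff c (dzbar u) (m + 1) s) := by
  have hz := continuousOn_dz Metric.isOpen_ball hu
  have hzb := continuousOn_dzbar Metric.isOpen_ball hu
  have hd : ∀ t : ℝ, HasDerivAt (fun t : ℝ => u (c + s * exp (t * I)) * exp (-(m * (t * I))))
      (I * (s * (dz u (c + s * exp (t * I)) * exp (-((m - 1 : ℤ) * (t * I))) -
        dzbar u (c + s * exp (t * I)) * exp (-((m + 1 : ℤ) * (t * I)))) -
        m * (u (c + s * exp (t * I)) * exp (-(m * (t * I)))))) t := fun t => by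
    have h0 : HasDerivAt (fun t : ℝ => -(m * ((t : ℂ) * I))) (-(m * I)) t := by
      have : HasDerivAt (fun t : ℝ => (t : ℂ) * I) I t := by
        simpa using (hasDerivAt_id t).ofReal_comp.mul_const I
      exact (this.const_mul (m : ℂ)).neg
    refine ((hasDerivAt_circle_angle hu hs t).mul h0.cexp).congr_deriv ?_
    rw [← exp_mul_exp_neg, ← exp_neg_mul_exp_neg]
    ring
  have c1 : Continuous fun t : ℝ => dz u (c + s * exp (t * I)) * exp (-((m - 1 : ℤ) * (t * I))) :=
    (continuous_on_circle hz hs).mul (by fun_prop)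
  have c2 : Continuous fun t : ℝ =>
      dzbar u (c + s * exp (t * I)) * exp (-((m + 1 : ℤ) * (t * I))) :=
    (continuous_on_circle hzb hs).mul (by fun_prop)
  have c3 : Continuous fun t : ℝ => u (c + s * exp (t * I)) * exp (-(m * (t * I))) :=
    (continuous_on_circle hu.continuousOn hs).mul (by fun_prop)
  have hint := intervalIntegral.integral_eq_sub_of_hasDerivAt (a := 0) (b := 2 * Real.pi)
    (fun t _ => hd t) (Continuous.intervalIntegrable (by fun_prop) _ _)
  rw [intervalIntegral.integral_const_mul, intervalIntegral.integral_sub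
    (Continuous.intervalIntegrable (by fun_prop) _ _)
    (Continuous.intervalIntegrable (by fun_prop) _ _), intervalIntegral.integral_const_mul,
    intervalIntegral.integral_const_mul, intervalIntegral.integral_sub
    (Continuous.intervalIntegrable (by fun_prop) _ _)
    (Continuous.intervalIntegrable (by fun_prop) _ _), exp_two_pi_int] at hint
  have e1 : exp ((2 * Real.pi : ℝ) * I) = 1 := by
    push_cast; exact exp_two_pi_mul_I
  rw [e1] at hint
  simp only [ofReal_zero, zero_mul, mul_zero, neg_zero, exp_zero, sub_self, mul_eq_zero, I_ne_zero,
    false_or] at hint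
  rw [circleCoeff, circleCoeff, circleCoeff]
  linear_combination -hint

/-- The radial and angular relations together eliminate u_z̄. For c = 0 this is Green's formula for
the form u ζ̄^m dζ̄, differentiated in the radius. -/
theorem hasDerivAt_pow_mul_circleCoeff_dz (hu : ContDiffOn ℝ 1 u (Metric.ball c R)) (m : ℕ)
    {s : ℝ} (hs : |s| < R) :
    HasDerivAt (fun s : ℝ => (s : ℂ) ^ (m + 1) * circleCoeff c u (m + 1) s)
      (2 * s ^ (m + 1) * circleCoeff c (dz u) m s) s := by
  have h1 := ((hasDerivAt_id s).ofReal_comp.pow (m + 1)).mul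
    (circleCoeff_hasDerivAt hu (m + 1) hs)
  have h2 := mul_circleCoeff hu (m + 1) hs
  refine h1.congr_deriv ?_
  push_cast at h2
  simp only [add_sub_cancel_right] at h2 ⊢
  simp only [id, Nat.add_sub_cancel, Pi.pow_apply]
  push_cast
  linear_combination ((s : ℂ) ^ m) * h2

theorem hasDerivAt_circleCoeff_zero (hu : ContDiffOn ℝ 1 u (Metric.ball c R)) {s : ℝ}
    (hs : |s| < R) :
    HasDerivAt (circleCoeff c u 0) (2 * circleCoeff c (dzbar u) 1 s) s := by
  have h1 := circleCoeff_hasDerivAt hu 0 hs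
  by_cases h0 : s = 0
  · subst h0
    refine h1.congr_deriv ?_
    -- The angular relation carries a factor s and says nothing about the derivatives at s = 0.
    -- There the circle is a point, and every coefficient of nonzero index vanishes.
    have e : ∀ (v : ℂ → ℂ) (m : ℤ), m ≠ 0 → circleCoeff c v m (0 : ℝ) = 0 := by
      intro v m hm
      have h2 := mul_circleCoeff (c := c) (R := 1) (u := fun _ => v c) contDiffOn_const m
        (s := 0) (by simp)
      have : circleCoeff c v m (0 : ℝ) = circleCoeff c (fun _ => v c) m (0 : ℝ) :=
        circleCoeff_congr fun t => by simp
      rw [this]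
      simpa [hm] using h2
    rw [e _ _ (by norm_num), e _ _ (by norm_num), e _ _ (by norm_num)]
    simp
  · have h2 := mul_circleCoeff hu 0 hs
    refine h1.congr_deriv ?_
    simp [h0] at h2
    simp
    linear_combination h2

end Relations

/-- Replaces integration in the radius: it suffices to exhibit an antiderivative `B` of the bound on
the derivative. -/
theorem norm_le_of_norm_deriv_le {W W' : ℝ → ℂ} {B B' : ℝ → ℝ} {r R : ℝ} (hr : 0 ≤ r)
    (hrR : r < R) (hW : ∀ s : ℝ, |s| < R → HasDerivAt W (W' s) s)
    (hB : ∀ s : ℝ, |s| < R → HasDerivAt B (B' s) s) (h0 : ‖W 0‖ ≤ B 0)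
    (h : ∀ s : ℝ, 0 ≤ s → s < R → ‖W' s‖ ≤ B' s) : ‖W r‖ ≤ B r := by
  have hs : ∀ s ∈ Icc 0 r, |s| < R := fun s hs => by
    rw [abs_of_nonneg hs.1]; exact hs.2.trans_lt hrR
  refine image_norm_le_of_norm_deriv_right_le_deriv_boundary' (a := 0) (b := r) (f' := W')
    (B' := B') (fun s hh => (hW s (hs s hh)).continuousAt.continuousWithinAt)
    (fun s hh => (hW s (hs s ⟨hh.1, hh.2.le⟩)).hasDerivWithinAt) h0
    (fun s hh => (hB s (hs s hh)).continuousAt.continuousWithinAt)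
    (fun s hh => (hB s (hs s ⟨hh.1, hh.2.le⟩)).hasDerivWithinAt)
    (fun s hh => h s hh.1 (hh.2.trans hrR)) ⟨hr, le_rfl⟩

/-! ### Estimates for functions with bounded Laplacian. -/

section Poisson

variable {c : ℂ} {R M : ℝ} {f : ℂ → ℂ}

theorem contDiffOn_conj_comp {n : ℕ∞} {U : Set ℂ} (hf : ContDiffOn ℝ n f U) :
    ContDiffOn ℝ n (fun w => conj (f w)) U :=
  conjCLE.contDiff.comp_contDiffOn hf

theorem norm_laplacian_conj_comp (z : ℂ) :
    ‖Laplacian.laplacian (fun w => conj (f w)) z‖ = ‖Laplacian.laplacian f z‖ := by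
  have h : Laplacian.laplacian (fun w => conj (f w)) = conjCLE ∘ Laplacian.laplacian f :=
    InnerProductSpace.laplacian_CLE_comp_left (f := f) (l := conjCLE)
  rw [h]
  simp

/-- Since the z-derivative of f_z̄ is Δf/4, Green's formula bounds the derivative of s^(n+1)
c_(n+1)(f_z̄) by 2s^(n+1) · 2π · M/4; integrate from 0. -/
theorem norm_circleCoeff_dzbar_le (hf : ContDiffOn ℝ 2 f (Metric.ball c R))
    (hM : ∀ z ∈ Metric.ball c R, ‖Laplacian.laplacian f z‖ ≤ M) (n : ℕ) {s : ℝ} (hs : 0 < s)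
    (hsR : s < R) :
    ‖circleCoeff c (dzbar f) (n + 1) s‖ ≤ Real.pi * M * s / (n + 2) := by
  have hu := contDiffOn_dzbar Metric.isOpen_ball hf
  have key := norm_le_of_norm_deriv_le (W := fun s : ℝ =>
      (s : ℂ) ^ (n + 1) * circleCoeff c (dzbar f) (n + 1) s)
    (B := fun s => Real.pi * M / (n + 2) * s ^ (n + 2))
    (B' := fun s => Real.pi * M * s ^ (n + 1)) hs.le hsR
    (fun s hs => hasDerivAt_pow_mul_circleCoeff_dz hu n hs) ?_ (by simp) ?_
  · simp only [norm_mul, norm_pow, norm_real, Real.norm_of_nonneg hs.le] at key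
    have hp : 0 < s ^ (n + 1) := by positivity
    rw [pow_succ s (n + 1)] at key
    have : s ^ (n + 1) * ‖circleCoeff c (dzbar f) (n + 1) s‖ ≤
        s ^ (n + 1) * (Real.pi * M * s / (n + 2)) := by
      refine key.trans_eq ?_
      ring
    exact le_of_mul_le_mul_left this hp
  · intro s _
    refine ((hasDerivAt_pow (n + 2) s).const_mul _).congr_deriv ?_
    push_cast
    field_simp
  · intro s h0 hsR
    have h1 : ‖circleCoeff c (dz (dzbar f)) n s‖ ≤ 2 * Real.pi * (M / 4) := by
      refine norm_circleCoeff_le fun t => ?_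
      have hm := mem_ball_circle (c := c) (R := R) (s := s) (by rwa [abs_of_nonneg h0]) t
      rw [(dzbar_dz (hf.contDiffAt (Metric.isOpen_ball.mem_nhds hm))).2, norm_div]
      have := hM _ hm
      simp
      linarith
    simp only [norm_mul, norm_pow, norm_real, Real.norm_of_nonneg h0, Complex.norm_ofNat]
    have := mul_le_mul_of_nonneg_left h1 (show 0 ≤ 2 * s ^ (n + 1) by positivity)
    refine this.trans_eq ?_
    ring

/-- Only f_z is measured in L¹; f_z̄ costs no more than the Laplacian. Applied also to the conjugate
of f, this makes |f_z| and |f_z̄| each appear once in the sum. -/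
theorem mul_norm_circleCoeff_le (hf : ContDiffOn ℝ 2 f (Metric.ball c R))
    (hM : ∀ z ∈ Metric.ball c R, ‖Laplacian.laplacian f z‖ ≤ M) (n : ℕ) {s : ℝ} (hs : 0 < s)
    (hsR : s < R) :
    n * ‖circleCoeff c f n s‖ ≤
      s * (∫ t in (0 : ℝ)..(2 * Real.pi), ‖dz f (c + s * exp (t * I))‖) +
        s * (Real.pi * M * s / (n + 2)) := by
  have h := mul_circleCoeff (hf.of_le (by norm_num)) n (s := s)
    (by rwa [abs_of_pos hs])
  have h2 := congrArg norm h
  simp only [norm_mul, norm_real, Real.norm_of_nonneg hs.le] at h2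
  rw [Int.cast_natCast, norm_natCast] at h2
  rw [h2, ← mul_add]
  refine mul_le_mul_of_nonneg_left ?_ hs.le
  refine (norm_sub_le _ _).trans (add_le_add ?_ ?_)
  · exact norm_circleCoeff_le_integral _ _ _ _
  · exact norm_circleCoeff_dzbar_le hf hM n hs hsR

/-- Interior gradient estimate for the Poisson equation. -/
theorem norm_dz_center_le {B : ℝ} (hf : ContDiffOn ℝ 2 f (Metric.ball c R))
    (hM : ∀ z ∈ Metric.ball c R, ‖Laplacian.laplacian f z‖ ≤ M)
    (hB : ∀ z ∈ Metric.ball c R, ‖f z‖ ≤ B) {s : ℝ} (hs : 0 < s) (hsR : s < R) :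
    ‖dz f c‖ * s ≤ B + M * s ^ 2 := by
  have hM0 : 0 ≤ M := (norm_nonneg _).trans (hM c (Metric.mem_ball_self (hs.trans hsR)))
  have hu := contDiffOn_dz Metric.isOpen_ball hf
  have h0 : circleCoeff c (dz f) 0 (0 : ℝ) = 2 * Real.pi * dz f c := by
    simp [circleCoeff]
  have h1 : ‖circleCoeff c (dz f) 0 s - circleCoeff c (dz f) 0 (0 : ℝ)‖ ≤ Real.pi * M * s := by
    refine norm_le_of_norm_deriv_le (W := fun s =>
      circleCoeff c (dz f) 0 s - circleCoeff c (dz f) 0 (0 : ℝ))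
      (B := fun s => Real.pi * M * s) (B' := fun _ => Real.pi * M) hs.le hsR
      (fun s hs => (hasDerivAt_circleCoeff_zero hu hs).sub_const _) ?_ (by simp) ?_
    · intro s _
      simpa using (hasDerivAt_id s).const_mul (Real.pi * M)
    · intro s h0 hsR
      have h1 : ‖circleCoeff c (dzbar (dz f)) 1 s‖ ≤ 2 * Real.pi * (M / 4) := by
        refine norm_circleCoeff_le fun t => ?_
        have hm := mem_ball_circle (c := c) (R := R) (s := s) (by rwa [abs_of_nonneg h0]) t
        rw [(dzbar_dz (hf.contDiffAt (Metric.isOpen_ball.mem_nhds hm))).1, norm_div]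
        have := hM _ hm
        simp
        linarith
      rw [norm_mul, Complex.norm_ofNat]
      linarith
  have h2 := mul_circleCoeff (hf.of_le (by norm_num)) 1 (s := s) (by rwa [abs_of_pos hs])
  have h3 : ‖circleCoeff c (dzbar f) 2 s‖ ≤ Real.pi * M * s / 3 := by
    have := norm_circleCoeff_dzbar_le hf hM 1 hs hsR
    norm_num at this
    exact this
  have h4 : ‖circleCoeff c f 1 s‖ ≤ 2 * Real.pi * B := norm_circleCoeff_le fun t =>
    hB _ (mem_ball_circle (by rwa [abs_of_pos hs]) t)
  -- The angular relation for m = 1, with c_0(f_z) split into its value at radius 0 and its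
  -- variation.
  have h5 : (s : ℂ) * (2 * Real.pi * dz f c) = circleCoeff c f 1 s +
      s * circleCoeff c (dzbar f) 2 s
      - s * (circleCoeff c (dz f) 0 s - circleCoeff c (dz f) 0 (0 : ℝ)) := by
    rw [h0]
    norm_num at h2
    linear_combination -h2
  have h6 := congrArg norm h5
  simp only [norm_mul, norm_real, Real.norm_of_nonneg hs.le, Complex.norm_ofNat,
    Real.norm_of_nonneg Real.pi_pos.le] at h6
  have h7 : s * (2 * Real.pi * ‖dz f c‖) ≤ 2 * Real.pi * B + s * (Real.pi * M * s / 3)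
      + s * (Real.pi * M * s) := by
    rw [h6]
    refine (norm_sub_le _ _).trans (add_le_add ((norm_add_le _ _).trans (add_le_add h4 ?_)) ?_)
    · rw [norm_mul, norm_real, Real.norm_of_nonneg hs.le]
      exact mul_le_mul_of_nonneg_left h3 hs.le
    · rw [norm_mul, norm_real, Real.norm_of_nonneg hs.le]
      exact mul_le_mul_of_nonneg_left h1 hs.le
  have h8 : 2 * Real.pi * (‖dz f c‖ * s) ≤ 2 * Real.pi * (B + M * s ^ 2) := by
    have : 0 ≤ Real.pi * (M * s ^ 2) := by positivity
    nlinarith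
  exact le_of_mul_le_mul_left h8 Real.two_pi_pos

theorem normD_center_le {B : ℝ} (hf : ContDiffOn ℝ 2 f (Metric.ball c R))
    (hM : ∀ z ∈ Metric.ball c R, ‖Laplacian.laplacian f z‖ ≤ M)
    (hB : ∀ z ∈ Metric.ball c R, ‖f z‖ ≤ B) {s : ℝ} (hs : 0 < s) (hsR : s < R) :
    normD f c * s ≤ 2 * (B + M * s ^ 2) := by
  have h1 := norm_dz_center_le hf hM hB hs hsR
  have h2 := norm_dz_center_le (f := fun w => conj (f w)) (B := B) (M := M)
    (contDiffOn_conj_comp (n := 2) hf)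
    (fun z hz => by rw [norm_laplacian_conj_comp]; exact hM z hz)
    (fun z hz => by simpa using hB z hz) hs hsR
  rw [dz_conj_comp, RCLike.norm_conj] at h2
  rw [normD]
  linarith

end Poisson

/-! ### Wirtinger's inequality and the isoperimetric inequality. -/

/-- Wirtinger's inequality for closed curves of mean zero. -/
theorem integral_norm_sq_le_of_integral_eq_zero {v v' : ℝ → ℂ} {T : ℝ} (hT : 0 < T)
    (hv : ∀ t, HasDerivAt v (v' t) t) (hv' : Continuous v') (hper : v T = v 0)
    (hmean : ∫ t in (0 : ℝ)..T, v t = 0) :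
    ∫ t in (0 : ℝ)..T, ‖v t‖ ^ 2 ≤ (T / (2 * Real.pi)) ^ 2 * ∫ t in (0 : ℝ)..T, ‖v' t‖ ^ 2 := by
  have hvc : Continuous v := continuous_iff_continuousAt.2 fun t => (hv t).continuousAt
  have hL : ∀ w : ℝ → ℂ, Continuous w → MemLp w 2 (volume.restrict (Ioc 0 T)) := fun w hw => by
    obtain ⟨C, hC⟩ := isCompact_Icc.exists_bound_of_continuousOn (s := Icc 0 T) hw.continuousOn
    exact MemLp.of_bound hw.aestronglyMeasurable C
      ((ae_restrict_iff' measurableSet_Ioc).2 (Eventually.of_forall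
        fun t ht => hC t ⟨ht.1.le, ht.2⟩))
  have h1 := hasSum_sq_fourierCoeffOn hT (hL v hvc)
  have h2 := (hasSum_sq_fourierCoeffOn hT (hL v' hv')).mul_left ((T / (2 * Real.pi)) ^ 2)
  -- Parseval on both sides, compared term by term: the coefficient of index 0 vanishes by the mean
  -- condition, and for n ≠ 0 periodicity gives v̂(n) = T/(2πin) v̂'(n).
  have h3 := hasSum_le (fun n => ?_) h1 h2
  · simp only [sub_zero, smul_eq_mul] at h3
    have h4 := mul_le_mul_of_nonneg_left h3 hT.le
    rw [← mul_assoc, mul_inv_cancel₀ hT.ne', one_mul] at h4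
    refine h4.trans_eq ?_
    field_simp
  · by_cases hn : n = 0
    · subst hn
      have h0 : fourierCoeffOn hT v 0 = 0 := by
        rw [fourierCoeffOn_eq_integral]
        simp [hmean]
      rw [h0]
      simp only [norm_zero, ne_eq, OfNat.ofNat_ne_zero, not_false_eq_true, zero_pow]
      positivity
    · rw [fourierCoeffOn_of_hasDerivAt hT hn (fun t _ => hv t) (hv'.intervalIntegrable _ _), hper,
        sub_self, mul_zero, zero_sub, ← mul_pow]
      refine pow_le_pow_left₀ (norm_nonneg _) ?_ 2
      have hn1 : (1 : ℝ) ≤ ‖(n : ℂ)‖ := by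
        rw [norm_intCast]; exact_mod_cast Int.one_le_abs hn
      simp only [norm_mul, norm_div, norm_neg, norm_one, norm_I, norm_real, Complex.norm_ofNat,
        Real.norm_of_nonneg Real.pi_pos.le, ofReal_zero, sub_zero, Real.norm_of_nonneg hT.le,
        mul_one]
      rw [← mul_assoc]
      refine mul_le_mul_of_nonneg_right ?_ (norm_nonneg _)
      rw [one_div, inv_mul_eq_div]
      refine div_le_div_of_nonneg_left hT.le Real.two_pi_pos ?_
      have := Real.two_pi_pos
      nlinarith

/-- The isoperimetric inequality for closed curves of speed at most one. -/
theorem im_integral_conj_mul_deriv_le_of_norm_le_one {γ γ' : ℝ → ℂ} {T : ℝ} (hT : 0 < T)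
    (hγ : ∀ t, HasDerivAt γ (γ' t) t) (hγ' : Continuous γ') (hper : γ T = γ 0)
    (h1 : ∀ t, ‖γ' t‖ ≤ 1) :
    (∫ t in (0 : ℝ)..T, conj (γ t) * γ' t).im ≤ T ^ 2 / (2 * Real.pi) := by
  have hγc : Continuous γ := continuous_iff_continuousAt.2 fun t => (hγ t).continuousAt
  set μ : ℂ := (∫ t in (0 : ℝ)..T, γ t) / T with hμ
  have hTc : (T : ℂ) ≠ 0 := by exact_mod_cast hT.ne'
  have hW := integral_norm_sq_le_of_integral_eq_zero (v := fun t => γ t - μ) hT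
    (fun t => (hγ t).sub_const μ) hγ' (by simp [hper]) (by
      rw [intervalIntegral.integral_sub (hγc.intervalIntegrable _ _) intervalIntegrable_const]
      simp only [intervalIntegral.integral_const, sub_zero, real_smul, hμ]
      field_simp
      simp)
  have h2 : ∫ t in (0 : ℝ)..T, ‖γ' t‖ ^ 2 ≤ T := by
    have := intervalIntegral.integral_mono_on (μ := volume) (f := fun t => ‖γ' t‖ ^ 2)
      (g := fun _ => (1 : ℝ)) hT.le
      (Continuous.intervalIntegrable (by fun_prop) _ _) intervalIntegrable_const
      fun t _ => pow_le_one₀ (norm_nonneg _) (h1 t)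
    simpa using this
  -- A closed curve has ∫γ' = 0, so the area does not change when the curve is translated to mean
  -- zero.
  have h3 : ∫ t in (0 : ℝ)..T, conj (γ t) * γ' t = ∫ t in (0 : ℝ)..T, conj (γ t - μ) * γ' t := by
    have h0 : ∫ t in (0 : ℝ)..T, γ' t = 0 := by
      rw [intervalIntegral.integral_eq_sub_of_hasDerivAt (fun t _ => hγ t)
        (hγ'.intervalIntegrable _ _), hper, sub_self]
    simp only [map_sub, sub_mul]
    have hcc : Continuous fun t => conj (γ t) := continuous_conj.comp hγc
    rw [intervalIntegral.integral_sub (Continuous.intervalIntegrable (by fun_prop) _ _)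
      (Continuous.intervalIntegrable (by fun_prop) _ _), intervalIntegral.integral_const_mul, h0]
    simp
  rw [h3]
  refine (im_le_norm _).trans ((intervalIntegral.norm_integral_le_integral_norm hT.le).trans ?_)
  have h4 : ∫ t in (0 : ℝ)..T, ‖conj (γ t - μ) * γ' t‖ ≤
      ∫ t in (0 : ℝ)..T, (Real.pi / T * ‖γ t - μ‖ ^ 2 + T / (4 * Real.pi)) := by
    have hcc : Continuous fun t => conj (γ t - μ) := continuous_conj.comp (by fun_prop)
    refine intervalIntegral.integral_mono_on hT.le (Continuous.intervalIntegrable (by fun_prop) _ _)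
      (Continuous.intervalIntegrable (by fun_prop) _ _) fun t _ => ?_
    rw [norm_mul, RCLike.norm_conj]
    have h5 : ‖γ t - μ‖ * ‖γ' t‖ ≤ ‖γ t - μ‖ := mul_le_of_le_one_right (norm_nonneg _) (h1 t)
    refine h5.trans ?_
    have hp := Real.pi_pos
    -- AM-GM weighted so that equality holds on the circle of length T, whose radius is T/(2π).
    have h6 : 0 ≤ Real.pi / T * (‖γ t - μ‖ - T / (2 * Real.pi)) ^ 2 := by positivity
    have h7 : Real.pi / T * (‖γ t - μ‖ - T / (2 * Real.pi)) ^ 2 =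
        Real.pi / T * ‖γ t - μ‖ ^ 2 + T / (4 * Real.pi) - ‖γ t - μ‖ := by
      field_simp
      ring
    linarith
  refine h4.trans ?_
  rw [intervalIntegral.integral_add (Continuous.intervalIntegrable (by fun_prop) _ _)
    intervalIntegrable_const, intervalIntegral.integral_const_mul]
  simp only [intervalIntegral.integral_const, sub_zero, smul_eq_mul]
  have hp := Real.pi_pos
  have h8 : ∫ t in (0 : ℝ)..T, ‖γ t - μ‖ ^ 2 ≤ (T / (2 * Real.pi)) ^ 2 * T :=
    hW.trans (mul_le_mul_of_nonneg_left h2 (by positivity))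
  have h9 := mul_le_mul_of_nonneg_left h8 (show 0 ≤ Real.pi / T by positivity)
  refine (add_le_add_left h9 _).trans_eq ?_
  field_simp
  ring

/-- The isoperimetric inequality for continuously differentiable closed curves: the enclosed signed
area is at most `L² / (4 π)`. -/
theorem im_integral_conj_mul_deriv_le {γ γ' : ℝ → ℂ} {T : ℝ} (hT : 0 < T)
    (hγ : ∀ t, HasDerivAt γ (γ' t) t) (hγ' : Continuous γ') (hper : γ T = γ 0) :
    (∫ t in (0 : ℝ)..T, conj (γ t) * γ' t).im ≤
      (∫ t in (0 : ℝ)..T, ‖γ' t‖) ^ 2 / (2 * Real.pi) := by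
  set ℓ := ∫ t in (0 : ℝ)..T, ‖γ' t‖ with hℓ
  have key : ∀ ε : ℝ, 0 < ε →
      (∫ t in (0 : ℝ)..T, conj (γ t) * γ' t).im ≤ (ℓ + ε * T) ^ 2 / (2 * Real.pi) := by
    intro ε hε
    -- Arc length regularized by ε: its derivative is positive even where γ' vanishes, so it can be
    -- inverted differentiably, and the new speed is at most 1.
    set σ : ℝ → ℝ := fun t => ∫ x in (0 : ℝ)..t, (‖γ' x‖ + ε) with hσ
    have hcont : Continuous fun x => ‖γ' x‖ + ε := by fun_prop
    have hpos : ∀ x, 0 < ‖γ' x‖ + ε := fun x => by positivity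
    have hσd : ∀ t, HasDerivAt σ (‖γ' t‖ + ε) t := fun t =>
      intervalIntegral.integral_hasDerivAt_right (hcont.intervalIntegrable _ _)
        (hcont.stronglyMeasurableAtFilter _ _) hcont.continuousAt
    have hσc : Continuous σ := continuous_iff_continuousAt.2 fun t => (hσd t).continuousAt
    have hmono : StrictMono σ := strictMono_of_deriv_pos fun t => by
      rw [(hσd t).deriv]; exact hpos t
    have hσ0 : σ 0 = 0 := by simp [hσ]
    -- Growth at rate at least ε in both directions makes σ surjective onto ℝ.
    have hlin : Monotone fun t => σ t - ε * t := by
      refine monotone_of_deriv_nonneg (fun t =>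
        ((hσd t).sub ((hasDerivAt_id t).const_mul ε)).differentiableAt) fun t => ?_
      have h := (hσd t).sub ((hasDerivAt_id t).const_mul ε)
      rw [show (fun t => σ t - ε * t) = σ - fun y => ε * id y from rfl, h.deriv]
      simp
    have hsurj : Function.Surjective σ := by
      refine hσc.surjective ?_ ?_
      · refine tendsto_atTop_mono' _ ?_ (tendsto_id.const_mul_atTop hε)
        filter_upwards [eventually_ge_atTop 0] with t ht
        have := hlin ht
        simp only [hσ0, mul_zero, sub_zero] at this
        simp only [id]
        linarith
      · refine tendsto_atBot_mono' _ ?_ (tendsto_id.const_mul_atBot hε)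
        filter_upwards [eventually_le_atBot 0] with t ht
        have := hlin ht
        simp only [hσ0, mul_zero, sub_zero] at this
        simp only [id]
        linarith
    set e := hmono.orderIsoOfSurjective σ hsurj with he
    have heσ : ∀ x, σ (e.symm x) = x := fun x => e.apply_symm_apply x
    have hσe : ∀ t, e.symm (σ t) = t := fun t => e.symm_apply_apply t
    have hec : Continuous e.symm := e.symm.continuous
    have hed : ∀ x, HasDerivAt e.symm (‖γ' (e.symm x)‖ + ε)⁻¹ x := fun x =>
      HasDerivAt.of_local_left_inverse hec.continuousAt (hσd _) (hpos _).ne'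
        (Eventually.of_forall heσ)
    have hΓ : ∀ x, HasDerivAt (fun x => γ (e.symm x))
        ((‖γ' (e.symm x)‖ + ε)⁻¹ • γ' (e.symm x)) x := fun x =>
      (hγ (e.symm x)).scomp x (hed x)
    have hΓc : Continuous fun x => (‖γ' (e.symm x)‖ + ε)⁻¹ • γ' (e.symm x) :=
      ((hcont.comp hec).inv₀ fun x => (hpos _).ne').smul (hγ'.comp hec)
    have hσT : σ T = ℓ + ε * T := by
      simp only [hσ, hℓ]
      rw [intervalIntegral.integral_add (Continuous.intervalIntegrable (by fun_prop) _ _)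
        intervalIntegrable_const]
      simp [mul_comm]
    have hTpos : 0 < σ T := hσ0 ▸ hmono hT
    have e0 : e.symm 0 = 0 := by rw [← hσ0, hσe, hσ0]
    have h := im_integral_conj_mul_deriv_le_of_norm_le_one hTpos hΓ hΓc
      (by rw [hσe, e0, hper]) fun x => by
        rw [norm_smul, norm_inv, Real.norm_of_nonneg (hpos _).le, inv_mul_le_iff₀ (hpos _), mul_one]
        linarith
    have hcv := intervalIntegral.integral_deriv_smul_comp (a := 0) (b := T) (f := σ)
      (f' := fun t => ‖γ' t‖ + ε)
      (g := fun x => conj (γ (e.symm x)) * ((‖γ' (e.symm x)‖ + ε)⁻¹ • γ' (e.symm x)))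
      (fun t _ => hσd t) hcont.continuousOn
      ((continuous_conj.comp (continuous_iff_continuousAt.2 fun x => (hΓ x).continuousAt)).mul hΓc)
    rw [hσ0] at hcv
    rw [← hcv, hσT] at h
    refine le_trans (le_of_eq ?_) h
    congr 1
    refine intervalIntegral.integral_congr fun t _ => ?_
    simp only [Function.comp, hσe, real_smul]
    have : ((‖γ' t‖ + ε : ℝ) : ℂ) ≠ 0 := by exact_mod_cast (hpos t).ne'
    rw [ofReal_inv]
    field_simp
  have hlim : Tendsto (fun ε : ℝ => (ℓ + ε * T) ^ 2 / (2 * Real.pi)) (𝓝[>] 0)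
      (𝓝 (ℓ ^ 2 / (2 * Real.pi))) := by
    have : Continuous fun ε : ℝ => (ℓ + ε * T) ^ 2 / (2 * Real.pi) := by fun_prop
    simpa using (this.tendsto 0).mono_left nhdsWithin_le_nhds
  exact ge_of_tendsto hlim (eventually_mem_nhdsWithin.mono fun ε hε => key ε hε)

/-! ### Poisson integrals, Cauchy transforms and harmonic expansions. -/

theorem hasSum_of_eq {f g : ℕ → ℂ} {a : ℂ} (h : HasSum f a) (e : ∀ n, g n = f n) : HasSum g a := by
  rwa [funext e]

theorem integral_exp_neg_int (k : ℤ) :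
    ∫ t in (0 : ℝ)..(2 * Real.pi), exp (-(k * (t * I))) =
      (if k = 0 then 2 * Real.pi else 0 : ℂ) := by
  split_ifs with hk
  · simp [hk]
  · have h := mul_circleCoeff (c := 0) (R := 2) (u := fun _ => 1) contDiffOn_const k (s := 1)
      (by norm_num)
    have h1 : ∀ m : ℤ, circleCoeff 0 (dz fun _ => 1) m 1 = 0 := fun m => by
      simp [circleCoeff, dz]
    have h2 : ∀ m : ℤ, circleCoeff 0 (dzbar fun _ => 1) m 1 = 0 := fun m => by
      simp [circleCoeff, dzbar]
    rw [h1, h2] at h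
    simpa [circleCoeff, hk] using h

theorem norm_mul_exp_neg (z : ℂ) (t : ℝ) : ‖z * exp (-(t * I))‖ = ‖z‖ := by
  have := norm_exp_neg_int 1 t
  simp only [Int.cast_one, one_mul] at this
  rw [norm_mul, this, mul_one]

theorem one_sub_ne_zero_of_norm_lt {w : ℂ} (hw : ‖w‖ < 1) : 1 - w ≠ 0 := by
  intro h
  rw [sub_eq_zero] at h
  rw [← h, norm_one] at hw
  exact lt_irrefl _ hw

/-- The (unnormalized) Cauchy transform of a function `u` of the angle. -/
def cauchyTransform (u : ℝ → ℂ) (z : ℂ) : ℂ :=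
  ∫ t in (0 : ℝ)..(2 * Real.pi), u t * (1 - z * exp (-(t * I)))⁻¹

theorem hasSum_cauchyTransform {u : ℝ → ℂ} (hu : Continuous u) {z : ℂ} (hz : ‖z‖ < 1) :
    HasSum (fun n : ℕ => (∫ t in (0 : ℝ)..(2 * Real.pi), u t * exp (-(n * (t * I)))) * z ^ n)
      (cauchyTransform u z) := by
  obtain ⟨C, hC⟩ := (isCompact_uIcc (a := 0) (b := 2 * Real.pi)).exists_bound_of_continuousOn
    hu.continuousOn
  have h := intervalIntegral.hasSum_integral_of_dominated_convergence (μ := volume)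
    (a := 0) (b := 2 * Real.pi) (F := fun (n : ℕ) t => u t * (z * exp (-(t * I))) ^ n)
    (f := fun t => u t * (1 - z * exp (-(t * I)))⁻¹) (fun n _ => C * ‖z‖ ^ n)
    (fun n => Continuous.aestronglyMeasurable (by fun_prop)) ?_ ?_ ?_ ?_
  · refine hasSum_of_eq h fun n => ?_
    rw [← intervalIntegral.integral_mul_const]
    refine intervalIntegral.integral_congr fun t _ => ?_
    simp only [mul_pow, ← exp_nat_mul]
    rw [mul_neg]
    ring
  · refine fun n => Eventually.of_forall fun t ht => ?_
    rw [norm_mul, norm_pow, norm_mul_exp_neg]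
    exact mul_le_mul_of_nonneg_right (hC t (uIoc_subset_uIcc ht)) (by positivity)
  · exact Eventually.of_forall fun t _ =>
      (summable_geometric_of_lt_one (norm_nonneg _) hz).mul_left C
  · exact intervalIntegrable_const
  · exact Eventually.of_forall fun t _ =>
      (hasSum_geometric_of_norm_lt_one (ξ := z * exp (-(t * I)))
        (by rwa [norm_mul_exp_neg])).mul_left (u t)

theorem hasDerivAt_cauchyTransform {u : ℝ → ℂ} (hu : Continuous u) {z : ℂ} (hz : ‖z‖ < 1) :
    HasDerivAt (cauchyTransform u)
      (∫ t in (0 : ℝ)..(2 * Real.pi), u t * (exp (-(t * I)) * ((1 - z * exp (-(t * I)))⁻¹) ^ 2))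
      z := by
  have hne : ∀ w ∈ Metric.ball (0 : ℂ) 1, ∀ t : ℝ, 1 - w * exp (-(t * I)) ≠ 0 := fun w hw t =>
    one_sub_ne_zero_of_norm_lt (by rw [norm_mul_exp_neg]; simpa using hw)
  refine hasDerivAt_integral_of_continuousOn (𝕜 := ℂ)
    (F := fun z t => u t * (1 - z * exp (-(t * I)))⁻¹)
    (F' := fun z t => u t * (exp (-(t * I)) * ((1 - z * exp (-(t * I)))⁻¹) ^ 2))
    (U := Metric.ball 0 1) Metric.isOpen_ball ?_ ?_ ?_ (by simpa using hz) 0 (2 * Real.pi)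
  · intro w hw
    exact hu.mul ((by fun_prop : Continuous fun t : ℝ => 1 - w * exp (-(t * I))).inv₀ (hne w hw))
  · have h1 : ContinuousOn (fun p : ℂ × ℝ => (1 - p.1 * exp (-(p.2 * I)))⁻¹)
        (Metric.ball 0 1 ×ˢ univ) :=
      (by fun_prop : Continuous fun p : ℂ × ℝ => 1 - p.1 * exp (-(p.2 * I))).continuousOn.inv₀
        fun p hp => hne p.1 hp.1 p.2
    have h2 : Continuous fun p : ℂ × ℝ => u p.2 := hu.comp continuous_snd
    exact h2.continuousOn.mul (ContinuousOn.mul (by fun_prop) (h1.pow 2))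
  · intro w hw t
    have h1 : HasDerivAt (fun w : ℂ => 1 - w * exp (-(t * I))) (-exp (-(t * I))) w := by
      simpa using ((hasDerivAt_id w).mul_const (exp (-(t * I)))).const_sub 1
    refine ((h1.inv (hne w hw t)).const_mul (u t)).congr_deriv ?_
    have := hne w hw t
    field_simp

/-- With w = z e^(-it), the kernel is (1 - |w|²)/|1 - w|². This splitting separates the Poisson
integral into holomorphic and antiholomorphic parts. -/
theorem poissonKernelDisk_eq {z : ℂ} (hz : ‖z‖ < 1) (t : ℝ) :
    (poissonKernelDisk z t : ℂ) = (1 - z * exp (-(t * I)))⁻¹ +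
      conj ((1 - z * exp (-(t * I)))⁻¹) - 1 := by
  have hn := norm_mul_exp_neg z t
  rw [poissonKernelDisk, ← hn]
  rw [← hn] at hz
  set w := z * exp (-(t * I))
  have h1 := one_sub_ne_zero_of_norm_lt hz
  have h2 : conj (1 - w) ≠ 0 := (map_ne_zero _).2 h1
  push_cast
  rw [← mul_conj', ← mul_conj', map_inv₀, div_eq_iff (mul_ne_zero h1 h2)]
  field_simp
  simp only [map_sub, map_one]
  ring

theorem poissonIntegral_eq {f : ℂ → ℂ} (hf : Continuous fun t : ℝ => f (exp (t * I))) {z : ℂ}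
    (hz : ‖z‖ < 1) :
    poissonIntegral f z = (1 / (2 * Real.pi) : ℂ) *
      (cauchyTransform (fun t => f (exp (t * I))) z +
        conj (cauchyTransform (fun t => conj (f (exp (t * I)))) z) -
        ∫ t in (0 : ℝ)..(2 * Real.pi), f (exp (t * I))) := by
  have hc : Continuous fun t : ℝ => (1 - z * exp (-(t * I)))⁻¹ :=
    (by fun_prop : Continuous fun t : ℝ => 1 - z * exp (-(t * I))).inv₀ fun t =>
      one_sub_ne_zero_of_norm_lt (by rwa [norm_mul_exp_neg])
  have k1 : Continuous fun t : ℝ => f (exp (t * I)) * (1 - z * exp (-(t * I)))⁻¹ := hf.mul hc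
  have k2 : Continuous fun t : ℝ =>
      conj (conj (f (exp (t * I))) * (1 - z * exp (-(t * I)))⁻¹) :=
    continuous_conj.comp ((continuous_conj.comp hf).mul hc)
  have k3 : Continuous fun t : ℝ => f (exp (t * I)) * (1 - z * exp (-(t * I)))⁻¹ +
      conj (conj (f (exp (t * I))) * (1 - z * exp (-(t * I)))⁻¹) := k1.add k2
  rw [poissonIntegral, cauchyTransform, cauchyTransform, ← intervalIntegral_conj,
    ← intervalIntegral.integral_add (k1.intervalIntegrable _ _) (k2.intervalIntegrable _ _),
    ← intervalIntegral.integral_sub (k3.intervalIntegrable _ _)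
      (hf.intervalIntegrable _ _)]
  congr 1
  refine intervalIntegral.integral_congr fun t _ => ?_
  simp only [poissonKernelDisk_eq hz, map_mul, conj_conj]
  ring

theorem hasHarmonicExpansion_poissonIntegral {f : ℂ → ℂ}
    (hf : Continuous fun t : ℝ => f (exp (t * I))) :
    HasHarmonicExpansion (poissonIntegral f)
      (fun n => (1 / (2 * Real.pi) : ℂ) * circleCoeff 0 f n 1)
      (fun n => (1 / (2 * Real.pi) : ℂ) * circleCoeff 0 (fun w => conj (f w)) n 1) := by
  intro z hz
  have hz : ‖z‖ < 1 := by simpa [disk] using hz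
  have h1 := (hasSum_cauchyTransform hf hz).mul_left (1 / (2 * Real.pi) : ℂ)
  have h2 := (hasSum_cauchyTransform (continuous_conj.comp hf) hz).mul_left (1 / (2 * Real.pi) : ℂ)
  -- The conjugate series loses its constant term, which cancels the integral subtracted in
  -- `poissonIntegral_eq`.
  have h3 := (hasSum_nat_add_iff' 1).2 (hasSum_conj'.2 h2)
  refine ⟨_, _, hasSum_of_eq h1 fun n => ?_, hasSum_of_eq h3 fun n => ?_, ?_⟩
  · simp [circleCoeff, mul_assoc]
  · simp [circleCoeff, mul_assoc]
  · rw [poissonIntegral_eq hf hz]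
    simp [← intervalIntegral_conj, Function.comp_def, map_ofNat]
    ring

/-- Convergence at the single point r gives absolute convergence, uniform on |ζ| = r, so the series
may be integrated term by term and orthogonality applies. -/
theorem hasSum_circleCoeff_of_expansion {F : ℂ → ℂ} {a b : ℕ → ℂ} (h : HasHarmonicExpansion F a b)
    {r : ℝ} (hr0 : 0 ≤ r) (hr : r < 1) (m : ℤ) :
    HasSum (fun n : ℕ => a n * r ^ n * (if m - n = 0 then 2 * Real.pi else 0 : ℂ) +
      conj (b (n + 1)) * r ^ (n + 1) * (if m + (n + 1) = 0 then 2 * Real.pi else 0 : ℂ))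
      (circleCoeff 0 F m r) := by
  have hrd : (r : ℂ) ∈ disk := by simpa [disk, abs_of_nonneg hr0] using hr
  obtain ⟨s, t, hs, ht, -⟩ := h r hrd
  have hs' := summable_norm_iff.2 hs.summable
  have ht' := summable_norm_iff.2 ht.summable
  simp only [norm_mul, norm_pow, RCLike.norm_conj] at hs' ht'
  have key := intervalIntegral.hasSum_integral_of_dominated_convergence (μ := volume)
    (a := 0) (b := 2 * Real.pi)
    (F := fun (n : ℕ) t => a n * r ^ n * exp (-((m - n : ℤ) * (t * I))) +
      conj (b (n + 1)) * r ^ (n + 1) * exp (-((m + (n + 1) : ℤ) * (t * I))))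
    (f := fun t => F (0 + r * exp (t * I)) * exp (-(m * (t * I))))
    (fun n _ => ‖a n‖ * ‖(r : ℂ)‖ ^ n + ‖b (n + 1)‖ * ‖(r : ℂ)‖ ^ (n + 1))
    (fun n => Continuous.aestronglyMeasurable (by fun_prop)) ?_ ?_ ?_ ?_
  · rw [circleCoeff]
    refine hasSum_of_eq key fun n => ?_
    rw [intervalIntegral.integral_add (Continuous.intervalIntegrable (by fun_prop) _ _)
      (Continuous.intervalIntegrable (by fun_prop) _ _), intervalIntegral.integral_const_mul,
      intervalIntegral.integral_const_mul, integral_exp_neg_int, integral_exp_neg_int]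
  · refine fun n => Eventually.of_forall fun t _ => (norm_add_le _ _).trans_eq ?_
    simp only [norm_mul, norm_exp_neg_int, norm_pow, RCLike.norm_conj, mul_one]
  · exact Eventually.of_forall fun _ _ => hs'.add ht'
  · exact intervalIntegrable_const
  · refine Eventually.of_forall fun θ _ => ?_
    have hmem : (0 + r * exp (θ * I) : ℂ) ∈ disk :=
      mem_ball_circle (by rwa [abs_of_nonneg hr0]) θ
    obtain ⟨s, t, hs, ht, hF⟩ := h _ hmem
    rw [hF, add_mul]
    refine hasSum_of_eq ((hs.mul_right _).add (ht.mul_right _)) fun n => ?_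
    congr 1
    · rw [zero_add, mul_pow, ← exp_nat_mul, ← mul_assoc (a n), mul_assoc _ (exp _) (exp _),
        ← exp_add]
      congr 2
      push_cast; ring
    · rw [zero_add, map_mul, conj_exp_mul_I, mul_pow, conj_ofReal, ← exp_nat_mul,
        ← mul_assoc (conj (b (n + 1))), mul_assoc _ (exp _) (exp _), ← exp_add]
      congr 2
      push_cast; ring

theorem circleCoeff_nat_of_expansion {F : ℂ → ℂ} {a b : ℕ → ℂ} (h : HasHarmonicExpansion F a b)
    {r : ℝ} (hr0 : 0 ≤ r) (hr : r < 1) (n : ℕ) :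
    circleCoeff 0 F n r = a n * r ^ n * (2 * Real.pi) := by
  refine (hasSum_circleCoeff_of_expansion h hr0 hr n).unique ?_
  convert hasSum_single n ?_ using 1
  · have : ¬ ((n : ℤ) + (n + 1) = 0) := by omega
    simp [this]
  · intro k hk
    have h1 : ¬ ((n : ℤ) + (k + 1) = 0) := by omega
    have h2 : ¬ ((n : ℤ) - k = 0) := by omega
    simp [h1, h2]

theorem circleCoeff_neg_of_expansion {F : ℂ → ℂ} {a b : ℕ → ℂ} (h : HasHarmonicExpansion F a b)
    {r : ℝ} (hr0 : 0 ≤ r) (hr : r < 1) (n : ℕ) :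
    circleCoeff 0 F (-(n + 1)) r = conj (b (n + 1)) * r ^ (n + 1) * (2 * Real.pi) := by
  refine (hasSum_circleCoeff_of_expansion h hr0 hr _).unique ?_
  convert hasSum_single n ?_ using 1
  · have : ¬ (-((n : ℤ) + 1) - n = 0) := by omega
    have h2 : (-((n : ℤ) + 1) + (n + 1) = 0) := by omega
    rw [if_neg this, if_pos h2]
    simp
  · intro k hk
    have h1 : ¬ (-((n : ℤ) + 1) - k = 0) := by omega
    have h2 : ¬ (-((n : ℤ) + 1) + (k + 1) = 0) := by omega
    rw [if_neg h1, if_neg h2]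
    simp

/-- The coefficients of a harmonic expansion of positive index are unique. -/
theorem HasHarmonicExpansion.unique {F : ℂ → ℂ} {a b a' b' : ℕ → ℂ}
    (h : HasHarmonicExpansion F a b) (h' : HasHarmonicExpansion F a' b') {n : ℕ} (hn : 1 ≤ n) :
    a n = a' n ∧ b n = b' n := by
  have hp : (2 * Real.pi : ℂ) ≠ 0 := by exact_mod_cast Real.two_pi_pos.ne'
  have hr : ∀ k : ℕ, (((1 / 2 : ℝ) : ℂ)) ^ k ≠ 0 := fun k => pow_ne_zero _ (by norm_num)
  obtain ⟨n, rfl⟩ := Nat.exists_eq_add_of_le' hn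
  have h0 : (0 : ℝ) ≤ 1 / 2 := by norm_num
  have h1 : (1 / 2 : ℝ) < 1 := by norm_num
  constructor
  · have e := (circleCoeff_nat_of_expansion h h0 h1 (n + 1)).symm.trans
      (circleCoeff_nat_of_expansion h' h0 h1 (n + 1))
    exact mul_right_cancel₀ (hr _) (mul_right_cancel₀ hp e)
  · have e := (circleCoeff_neg_of_expansion h h0 h1 n).symm.trans
      (circleCoeff_neg_of_expansion h' h0 h1 n)
    exact (starRingEnd ℂ).injective (mul_right_cancel₀ (hr _) (mul_right_cancel₀ hp e))

/-- Carries estimates proved on interior circles to the boundary, where only continuity is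
available. -/
theorem tendsto_circleCoeff {Φ : ℂ → ℂ} (hΦ : ContinuousOn Φ closedDisk) (m : ℤ) :
    Tendsto (circleCoeff 0 Φ m) (𝓝[<] 1) (𝓝 (circleCoeff 0 Φ m 1)) := by
  obtain ⟨C, hC⟩ := (isCompact_closedBall (0 : ℂ) 1).exists_bound_of_continuousOn hΦ
  have hmem : ∀ r : ℝ, 0 ≤ r → r ≤ 1 → ∀ t : ℝ, (0 + r * exp (t * I) : ℂ) ∈ closedDisk := by
    intro r h0 h1 t
    simpa [closedDisk, norm_exp_ofReal_mul_I, abs_of_nonneg h0] using h1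
  have hev : ∀ᶠ r : ℝ in 𝓝[<] 1, 0 ≤ r ∧ r ≤ 1 := by
    filter_upwards [Ioo_mem_nhdsLT (zero_lt_one' ℝ)] with r hr using ⟨hr.1.le, hr.2.le⟩
  refine intervalIntegral.tendsto_integral_filter_of_dominated_convergence (fun _ => C) ?_ ?_ ?_ ?_
  · filter_upwards [hev] with r hr
    exact ((hΦ.comp_continuous (by fun_prop) (hmem r hr.1 hr.2)).mul
      (by fun_prop)).aestronglyMeasurable
  · filter_upwards [hev] with r hr
    refine Eventually.of_forall fun t _ => ?_
    rw [norm_mul, norm_exp_neg_int, mul_one]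
    exact hC _ (hmem r hr.1 hr.2 t)
  · exact intervalIntegrable_const
  · refine Eventually.of_forall fun t _ => Tendsto.mul_const _ ?_
    have h1 : Tendsto (fun r : ℝ => (0 + r * exp (t * I) : ℂ)) (𝓝[<] 1)
        (𝓝[closedDisk] (0 + (1 : ℝ) * exp (t * I))) := by
      refine tendsto_nhdsWithin_iff.2 ⟨?_, hev.mono fun r hr => hmem r hr.1 hr.2 t⟩
      have : Continuous fun r : ℝ => (0 + r * exp (t * I) : ℂ) := by fun_prop
      exact (this.tendsto 1).mono_left nhdsWithin_le_nhds
    exact (hΦ _ (hmem 1 zero_le_one le_rfl t)).tendsto.comp h1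

theorem continuous_boundary {f : ℂ → ℂ} (hf : ContinuousOn f closedDisk) :
    Continuous fun t : ℝ => f (exp (t * I)) :=
  hf.comp_continuous (by fun_prop) fun t => by simp [closedDisk, norm_exp_ofReal_mul_I]

/-- The square of the Szegő kernel, as an antiholomorphic function of the second variable. -/
def bergmanKernel (z ζ : ℂ) : ℂ := ((1 - z * conj ζ)⁻¹) ^ 2

/-- Differentiating the two Cauchy transforms gives the kernel e^(-it)(1 - z e^(-it))⁻². Writing
e^(-it) as the frequency and the rest as an antiholomorphic function of ζ lets the coefficient be
moved to smaller circles. -/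
theorem normD_poissonIntegral {f : ℂ → ℂ} (hf : ContinuousOn f closedDisk) {z : ℂ}
    (hz : ‖z‖ < 1) :
    normD (poissonIntegral f) z = 1 / (2 * Real.pi) *
      (‖circleCoeff 0 (fun ζ => f ζ * bergmanKernel z ζ) 1 1‖ +
        ‖circleCoeff 0 (fun ζ => conj (f ζ) * bergmanKernel z ζ) 1 1‖) := by
  have hb := continuous_boundary hf
  have h1 := hasDerivAt_cauchyTransform hb hz
  have h2 := hasDerivAt_cauchyTransform (continuous_conj.comp hb) hz
  set u : ℝ → ℂ := fun t => f (exp (t * I))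
  have e : ∀ v : ℂ → ℂ, circleCoeff 0 (fun ζ => v ζ * bergmanKernel z ζ) 1 1 =
      ∫ t in (0 : ℝ)..(2 * Real.pi), v (exp (t * I)) *
        (exp (-(t * I)) * ((1 - z * exp (-(t * I)))⁻¹) ^ 2) := fun v => by
    refine intervalIntegral.integral_congr fun t _ => ?_
    simp only [bergmanKernel, ofReal_one, one_mul, zero_add, conj_exp_mul_I, Int.cast_one]
    ring
  rw [e, e]
  have hev : poissonIntegral f =ᶠ[𝓝 z] fun w =>
      ((1 / (2 * Real.pi) : ℂ) * cauchyTransform u w) +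
        (conj ((1 / (2 * Real.pi) : ℂ) * cauchyTransform (conj ∘ u) w) +
        (-(1 / (2 * Real.pi) : ℂ) * ∫ t in (0 : ℝ)..(2 * Real.pi), u t)) := by
    filter_upwards [Metric.isOpen_ball.mem_nhds (show z ∈ Metric.ball (0 : ℂ) 1 by simpa using hz)]
      with w hw
    rw [poissonIntegral_eq hb (by simpa using hw)]
    simp [u, Function.comp_def, map_ofNat]
    ring
  have hd1 := h1.const_mul (1 / (2 * Real.pi) : ℂ)
  have hd2 := h2.const_mul (1 / (2 * Real.pi) : ℂ)
  have r1 : DifferentiableAt ℝ (fun w => (1 / (2 * Real.pi) : ℂ) * cauchyTransform u w) z :=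
    (hd1.hasFDerivAt.restrictScalars ℝ).differentiableAt
  have r2 : DifferentiableAt ℝ (fun w => conj ((1 / (2 * Real.pi) : ℂ) *
      cauchyTransform (conj ∘ u) w)) z :=
    conjCLE.differentiableAt.comp z (hd2.hasFDerivAt.restrictScalars ℝ).differentiableAt
  have r3 : ∀ κ : ℂ, DifferentiableAt ℝ (fun _ : ℂ => κ) z := fun κ => differentiableAt_const _
  have z1 : ∀ κ : ℂ, dz (fun _ : ℂ => κ) z = 0 := fun κ => dz_of_hasDerivAt (hasDerivAt_const z κ)
  have z2 : ∀ κ : ℂ, dzbar (fun _ : ℂ => κ) z = 0 :=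
    fun κ => dzbar_of_hasDerivAt (hasDerivAt_const z κ)
  have r4 : DifferentiableAt ℝ (fun w => conj ((1 / (2 * Real.pi) : ℂ) *
      cauchyTransform (conj ∘ u) w) +
      (-(1 / (2 * Real.pi) : ℂ) * ∫ t in (0 : ℝ)..(2 * Real.pi), u t)) z := r2.add (r3 _)
  have c1 := dz_add r1 r4
  rw [dz_add r2 (r3 _), dz_conj_comp, dz_of_hasDerivAt hd1, dzbar_of_hasDerivAt hd2, z1, dz,
    ← hev.fderiv_eq, ← dz] at c1
  have c2 := dzbar_add r1 r4
  rw [dzbar_add r2 (r3 _), dzbar_conj_comp, dzbar_of_hasDerivAt hd1, dz_of_hasDerivAt hd2, z2,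
    dzbar, ← hev.fderiv_eq, ← dzbar] at c2
  rw [normD, c1, c2]
  simp [u, abs_of_pos Real.pi_pos]
  ring

/-! ### Sign of the Jacobian. -/

/-- A sense-preserving function has nonnegative Jacobian wherever it is differentiable. -/
theorem SensePreservingOn.jacobian_nonneg {f : ℂ → ℂ} {Ω : Set ℂ} (h : SensePreservingOn f Ω)
    {z : ℂ} (hz : z ∈ Ω) (hd : DifferentiableAt ℝ f z) : 0 ≤ jacobian f z := by
  by_contra hneg
  rw [jacobian, not_le, sub_neg] at hneg
  set p := dz f z
  set q := dzbar f z
  have hpq : ‖p‖ < ‖q‖ := lt_of_pow_lt_pow_left₀ 2 (norm_nonneg _) hneg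
  have hq : 0 < ‖q‖ := (norm_nonneg _).trans_lt hpq
  have hq0 : q ≠ 0 := norm_pos_iff.1 hq
  have hε : 0 < (‖q‖ - ‖p‖) / 2 := by linarith
  have hlin := hd.hasFDerivAt.isLittleO.def hε
  rw [Metric.eventually_nhds_iff] at hlin
  obtain ⟨δ, hδ, hδ'⟩ := hlin
  obtain ⟨r, ⟨θ, hθc, hθ, hθ2⟩, hr0, hrδ⟩ := ((h z hz).and (Ioo_mem_nhdsGT hδ)).exists
  have hr0c : (r : ℂ) ≠ 0 := by exact_mod_cast hr0.ne'
  -- If |f_z| < |f_z̄|, then f(z + re^(it)) - f(z) is dominated by q r e^(-it), which winds once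
  -- clockwise. Q is their quotient; it stays in the disc |Q - 1| < 1, hence has a continuous
  -- logarithm.
  set Q : ℝ → ℂ := fun t => exp (θ t) * exp (t * I) / (r * q) with hQ
  have hQ1 : ∀ t, ‖Q t - 1‖ < 1 := fun t => by
    have h1 := @hδ' (z + r * exp (t * I)) (by
      simpa [norm_exp_ofReal_mul_I, abs_of_pos hr0] using hrδ)
    rw [hθ, add_sub_cancel_left, fderiv_apply_eq_dz_add_dzbar, norm_mul, norm_exp_ofReal_mul_I,
      mul_one, norm_real, Real.norm_of_nonneg hr0.le, map_mul, conj_exp_mul_I, conj_ofReal] at h1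
    have hee : exp (t * I) * exp (-(t * I)) = 1 := by rw [← exp_add]; simp
    have e1 : (Q t - 1) * (r * q) = (exp (θ t) - (p * (r * exp (t * I)) +
        q * (r * exp (-(t * I))))) * exp (t * I) + p * (r * exp (t * I)) * exp (t * I) := by
      simp only [hQ]
      rw [sub_mul, div_mul_cancel₀ _ (mul_ne_zero hr0c hq0)]
      linear_combination (q * r) * hee
    have e2 := congrArg norm e1
    rw [norm_mul, norm_mul, norm_real, Real.norm_of_nonneg hr0.le] at e2
    have e3 := norm_add_le ((exp (θ t) - (p * (r * exp (t * I)) +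
        q * (r * exp (-(t * I))))) * exp (t * I)) (p * (r * exp (t * I)) * exp (t * I))
    rw [← e2] at e3
    simp only [norm_mul, norm_exp_ofReal_mul_I, mul_one, norm_real,
      Real.norm_of_nonneg hr0.le] at e3
    have e4 : ‖Q t - 1‖ * (r * ‖q‖) < 1 * (r * ‖q‖) := by nlinarith
    exact lt_of_mul_lt_mul_right e4 (by positivity)
  have hQs : ∀ t, Q t ∈ slitPlane := fun t => by
    refine mem_slitPlane_iff.2 (Or.inl ?_)
    have := (abs_le.1 (abs_re_le_norm (Q t - 1))).1
    rw [sub_re, one_re] at this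
    linarith [hQ1 t]
  have hQc : Continuous Q := by
    simp only [hQ]
    fun_prop
  -- A continuous branch of the logarithm of the constant rq, so it can only jump by multiples of
  -- 2πi; yet it gains 4πi over one turn. By the intermediate value theorem its imaginary part also
  -- gains π, a contradiction.
  set k : ℝ → ℂ := fun t => θ t + t * I - log (Q t) with hk
  have hkc : Continuous k := by
    have : Continuous fun t => log (Q t) := continuous_iff_continuousAt.2 fun t =>
      hQc.continuousAt.clog (hQs t)
    simp only [hk]
    fun_prop
  have hke : ∀ t, exp (k t) = r * q := fun t => by
    simp only [hk]
    rw [exp_sub, exp_log (slitPlane_ne_zero (hQs t)), exp_add, hQ]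
    have h1 := exp_ne_zero (θ t)
    have h2 := exp_ne_zero (t * I)
    field_simp
  have hQper : Q (2 * Real.pi) = Q 0 := by
    have h1 : exp (θ (2 * Real.pi)) = exp (θ 0) := by
      rw [← hθ, ← hθ]
      push_cast
      rw [exp_two_pi_mul_I]
      simp
    simp only [hQ, h1]
    push_cast
    rw [exp_two_pi_mul_I]
    simp
  have hkd : k (2 * Real.pi) - k 0 = (4 * Real.pi : ℝ) * I := by
    simp only [hk, hQper]
    push_cast
    linear_combination hθ2
  set N : ℝ → ℝ := fun t => (k t - k 0).im with hN
  have hNc : Continuous N := continuous_im.comp (hkc.sub continuous_const)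
  have hN0 : N 0 = 0 := by simp [hN]
  have hN2 : N (2 * Real.pi) = 4 * Real.pi := by
    simp only [hN, hkd]
    rw [im_ofReal_mul]
    simp
  obtain ⟨t, ht⟩ := mem_range_of_exists_le_of_exists_ge hNc
    (c := Real.pi) ⟨0, by rw [hN0]; exact Real.pi_pos.le⟩
    ⟨2 * Real.pi, by rw [hN2]; linarith [Real.pi_pos]⟩
  obtain ⟨n, hn⟩ := exp_eq_exp_iff_exists_int.1 ((hke t).trans (hke 0).symm)
  have h1 : N t = n * (2 * Real.pi) := by
    simp only [hN, hn, add_sub_cancel_left]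
    rw [show (n : ℂ) * (2 * Real.pi * I) = ((n * (2 * Real.pi) : ℝ) : ℂ) * I by push_cast; ring]
    rw [im_ofReal_mul]
    simp
  rw [ht] at h1
  have h2 : (n : ℝ) * 2 = 1 := by
    have := Real.pi_pos.ne'
    field_simp at h1
    linarith
  have h3 : n * 2 = 1 := by exact_mod_cast h2
  omega

/-! ### The antiholomorphic kernel and its L² norm on circles. -/

section Kernel

variable {z : ℂ}

theorem bergmanKernel_eq_conj (z ζ : ℂ) :
    bergmanKernel z ζ = conj (((1 - conj z * ζ)⁻¹) ^ 2) := by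
  simp [bergmanKernel]

theorem one_sub_mul_ne_zero (hz : ‖z‖ < 1) {ζ : ℂ} (hζ : ‖ζ‖ ≤ 1) : 1 - z * ζ ≠ 0 :=
  one_sub_ne_zero_of_norm_lt (by
    rw [norm_mul]
    exact (mul_le_of_le_one_right (norm_nonneg _) hζ).trans_lt hz)

theorem continuousOn_bergmanKernel (hz : ‖z‖ < 1) :
    ContinuousOn (bergmanKernel z) closedDisk := by
  unfold bergmanKernel
  have h : ContinuousOn (fun ζ : ℂ => 1 - z * conj ζ) closedDisk :=
    (continuous_const.sub (continuous_const.mul continuous_conj)).continuousOn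
  exact (h.inv₀ fun ζ hζ => one_sub_mul_ne_zero hz (by simpa [closedDisk] using hζ)).pow 2

theorem contDiffOn_bergmanKernel (hz : ‖z‖ < 1) :
    ContDiffOn ℝ 1 (bergmanKernel z) (Metric.ball 0 1) := by
  unfold bergmanKernel
  have h : ContDiff ℝ 1 (fun ζ : ℂ => 1 - z * conj ζ) :=
    contDiff_const.sub (contDiff_const.mul conjCLE.contDiff)
  exact (h.contDiffOn.inv fun ζ hζ => one_sub_mul_ne_zero hz (by
    simpa using (le_of_lt (by simpa using hζ : ‖ζ‖ < 1)))).pow 2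

/-- Because of this, the z-derivative of f times the kernel falls on f alone. -/
theorem dz_bergmanKernel (hz : ‖z‖ < 1) {ζ : ℂ} (hζ : ‖ζ‖ < 1) : dz (bergmanKernel z) ζ = 0 := by
  have h : bergmanKernel z = fun ζ => conj (((1 - conj z * ζ)⁻¹) ^ 2) :=
    funext fun ζ => bergmanKernel_eq_conj z ζ
  have h1 : HasDerivAt (fun ζ : ℂ => 1 - conj z * ζ) (-conj z) ζ := by
    simpa using ((hasDerivAt_id ζ).const_mul (conj z)).const_sub 1
  have h2 := (h1.inv (one_sub_mul_ne_zero (by simpa using hz) hζ.le)).pow 2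
  rw [h, dz_conj_comp, dzbar_of_hasDerivAt (f := fun ζ => ((1 - conj z * ζ)⁻¹) ^ 2) h2, map_zero]

/-- The mean of `|1 - z ζ̄|⁻⁴` over a circle. -/
theorem integral_norm_bergmanKernel_sq (hz : ‖z‖ < 1) {s : ℝ} (hs : |s| < 1) :
    ∫ t in (0 : ℝ)..(2 * Real.pi), ‖bergmanKernel z (0 + s * exp (t * I))‖ ^ 2 =
      2 * Real.pi * (1 + ‖z‖ ^ 2 * s ^ 2) / (1 - ‖z‖ ^ 2 * s ^ 2) ^ 3 := by
  set a : ℂ := z * s with ha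
  have hna : ‖a‖ ^ 2 = ‖z‖ ^ 2 * s ^ 2 := by
    rw [ha, norm_mul, mul_pow, norm_real, Real.norm_eq_abs, sq_abs]
  have ha1 : ‖a‖ < 1 := by
    rw [ha, norm_mul, norm_real, Real.norm_eq_abs]
    nlinarith [norm_nonneg z, abs_nonneg s]
  have hca : ‖conj a‖ < 1 := by simpa using ha1
  have haa : conj a * a = ((‖a‖ ^ 2 : ℝ) : ℂ) := by rw [conj_mul']; push_cast; rfl
  have hne : ∀ ζ : ℂ, ‖ζ‖ ≤ 1 → 1 - conj a * ζ ≠ 0 := fun ζ hζ => one_sub_mul_ne_zero hca hζ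
  have hlin : ∀ ζ : ℂ, HasDerivAt (fun ζ : ℂ => 1 - conj a * ζ) (-conj a) ζ := fun ζ => by
    simpa using ((hasDerivAt_id ζ).const_mul (conj a)).const_sub 1
  -- With a = zs and ζ = e^(it), |1 - ā ζ|⁻⁴ dt equals φ(ζ)(ζ - a)⁻² dζ / i, so Cauchy's formula
  -- evaluates the mean as 2πφ'(a).
  set φ : ℂ → ℂ := fun ζ => ζ * ((1 - conj a * ζ)⁻¹) ^ 2 with hφ
  have hφd : ∀ ζ : ℂ, 1 - conj a * ζ ≠ 0 → HasDerivAt φ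
      ((1 + conj a * ζ) * ((1 - conj a * ζ)⁻¹) ^ 3) ζ := fun ζ hζ => by
    refine ((hasDerivAt_id ζ).mul (((hlin ζ).inv hζ).pow 2)).congr_deriv ?_
    simp
    field_simp
    ring
  have hU : IsOpen {ζ : ℂ | 1 - conj a * ζ ≠ 0} :=
    isOpen_ne_fun (by fun_prop) continuous_const
  have hcauchy := two_pi_I_inv_smul_circleIntegral_sub_sq_inv_smul_of_differentiable
    (f := φ) (c := 0) (R := 1) (w₀ := a) hU (fun ζ hζ => hne ζ (by simpa using hζ))
    (fun ζ hζ => (hφd ζ hζ).differentiableAt.differentiableWithinAt) (by simpa using ha1)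
  rw [(hφd a (hne a ha1.le)).deriv, haa] at hcauchy
  have hint : (∮ ζ in C(0, 1), ((ζ - a) ^ 2)⁻¹ • φ ζ) =
      I * ((∫ t in (0 : ℝ)..(2 * Real.pi), ‖bergmanKernel z (0 + s * exp (t * I))‖ ^ 2 : ℝ) : ℂ) := by
    rw [circleIntegral, ← intervalIntegral.integral_ofReal, ← intervalIntegral.integral_const_mul]
    refine intervalIntegral.integral_congr fun t _ => ?_
    have h1 : conj (exp (t * I)) = (exp (t * I))⁻¹ := by rw [conj_exp_mul_I, exp_neg]
    have h2 := exp_ne_zero (t * I)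
    have h3 : exp (t * I) - a ≠ 0 := by
      intro h
      rw [sub_eq_zero] at h
      rw [← h, norm_exp_ofReal_mul_I] at ha1
      exact lt_irrefl _ ha1
    have h4 := hne (exp (t * I)) (norm_exp_ofReal_mul_I t).le
    have h5 : bergmanKernel z (0 + s * exp (t * I)) =
        (exp (t * I) * (exp (t * I) - a)⁻¹) ^ 2 := by
      rw [bergmanKernel, zero_add, map_mul, conj_ofReal, h1, ← mul_assoc, ← ha]
      congr 1
      rw [inv_eq_iff_eq_inv, mul_inv, inv_inv]
      field_simp
    have h6 : conj (bergmanKernel z (0 + s * exp (t * I))) = ((1 - conj a * exp (t * I))⁻¹) ^ 2 := by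
      rw [bergmanKernel_eq_conj, conj_conj, zero_add, ha, map_mul, conj_ofReal, mul_assoc]
    simp only [deriv_circleMap, circleMap, ofReal_one, one_mul, zero_add, smul_eq_mul, hφ]
    rw [zero_add] at h5 h6
    push_cast
    rw [← mul_conj', h6, h5]
    field_simp
  rw [hint] at hcauchy
  rw [← hna]
  have hden : (1 - ‖a‖ ^ 2) ≠ 0 := by nlinarith [norm_nonneg a]
  have hfin : ((∫ t in (0 : ℝ)..(2 * Real.pi), ‖bergmanKernel z (0 + s * exp (t * I))‖ ^ 2 : ℝ) : ℂ)
      = ((2 * Real.pi * (1 + ‖a‖ ^ 2) / (1 - ‖a‖ ^ 2) ^ 3 : ℝ) : ℂ) := by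
    rw [smul_eq_mul, inv_mul_eq_iff_eq_mul₀ two_pi_I_ne_zero] at hcauchy
    have := mul_left_cancel₀ I_ne_zero (hcauchy.trans
      (show _ = I * ((2 * Real.pi) * ((1 + ((‖a‖ ^ 2 : ℝ) : ℂ)) *
        ((1 - ((‖a‖ ^ 2 : ℝ) : ℂ))⁻¹) ^ 3)) by ring))
    rw [this]
    push_cast
    rw [div_eq_mul_inv, inv_pow]
    ring
  exact_mod_cast hfin

end Kernel

/-! ### Enclosed area and the weighted energy estimate. -/

section Area

variable {f : ℂ → ℂ}

/-- The signed area enclosed by the image of the circle `|z| = s`. -/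
def circleArea (f : ℂ → ℂ) (s : ℝ) : ℝ :=
  (∫ t in (0 : ℝ)..(2 * Real.pi), conj (f (0 + s * exp (t * I))) *
    (I * s * (dz f (0 + s * exp (t * I)) * exp (t * I) -
        dzbar f (0 + s * exp (t * I)) * exp (-(t * I))))).im / 2

/-- Up to the unimodular factor e^(it), the integrand of the perimeter is the speed of t ↦
f(re^(it)), the form needed for the isoperimetric inequality. -/
theorem perimeter_eq_integral_norm {r : ℝ} (hr : 0 ≤ r) :
    perimeter f r = ∫ t in (0 : ℝ)..(2 * Real.pi),
      ‖I * r * (dz f (0 + r * exp (t * I)) * exp (t * I) -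
        dzbar f (0 + r * exp (t * I)) * exp (-(t * I)))‖ := by
  rw [perimeter, ← intervalIntegral.integral_const_mul]
  refine intervalIntegral.integral_congr fun t _ => ?_
  have h : exp (-(2 * t * I)) * exp (t * I) = exp (-(t * I)) := by
    rw [← exp_add]; congr 1; ring
  have e : dz f (0 + r * exp (t * I)) * exp (t * I) -
      dzbar f (0 + r * exp (t * I)) * exp (-(t * I)) =
      (dz f (r * exp (t * I)) - exp (-(2 * t * I)) * dzbar f (r * exp (t * I))) *
        exp (t * I) := by
    rw [zero_add]
    linear_combination (dzbar f (r * exp (t * I))) * h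
  simp only [e, norm_mul, norm_I, norm_real, Real.norm_of_nonneg hr, norm_exp_ofReal_mul_I]
  ring

theorem circleArea_le (hf : ContDiffOn ℝ 1 f (Metric.ball 0 1)) {r : ℝ} (hr : 0 ≤ r) (hr1 : r < 1) :
    circleArea f r ≤ perimeter f r ^ 2 / (4 * Real.pi) := by
  have hra : |r| < 1 := by rwa [abs_of_nonneg hr]
  have h := im_integral_conj_mul_deriv_le Real.two_pi_pos
    (fun t => hasDerivAt_circle_angle hf hra t)
    (by
      have h1 := continuous_on_circle (continuousOn_dz Metric.isOpen_ball hf) hra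
      have h2 := continuous_on_circle (continuousOn_dzbar Metric.isOpen_ball hf) hra
      fun_prop)
    (by push_cast; rw [exp_two_pi_mul_I]; simp)
  rw [perimeter_eq_integral_norm hr, circleArea]
  have e : ∀ x : ℝ, x / (4 * Real.pi) = x / (2 * Real.pi) / 2 := fun x => by field_simp; ring
  rw [e]
  linarith

/-- Green's formula applied to f·conj(f_z) and conj(f)·f_z̄. Their z-derivatives contain
f·conj(Δf)/4 and conj(f)·Δf/4, which are conjugate and cancel in the real part of the difference,
leaving the Jacobian. -/
theorem hasDerivAt_circleArea (hf : ContDiffOn ℝ 2 f (Metric.ball 0 1)) {s : ℝ} (hs : |s| < 1) :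
    HasDerivAt (circleArea f)
      (s * ∫ t in (0 : ℝ)..(2 * Real.pi), jacobian f (0 + s * exp (t * I))) s := by
  have hf1 : ContDiffOn ℝ 1 f (Metric.ball 0 1) := hf.of_le (by norm_num)
  have hz := contDiffOn_dz Metric.isOpen_ball hf
  have hzb := contDiffOn_dzbar Metric.isOpen_ball hf
  have hzc : ContDiffOn ℝ 1 (fun w => conj (dz f w)) (Metric.ball 0 1) :=
    contDiffOn_conj_comp (n := 1) hz
  have hfc : ContDiffOn ℝ 1 (fun w => conj (f w)) (Metric.ball 0 1) :=
    contDiffOn_conj_comp (n := 1) hf1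
  have hu := hf1.mul hzc
  have hv := hfc.mul hzb
  have hdat : ∀ {v : ℂ → ℂ}, ContDiffOn ℝ 1 v (Metric.ball 0 1) → ∀ w ∈ Metric.ball (0 : ℂ) 1,
      DifferentiableAt ℝ v w := fun hv w hw =>
    (hv.contDiffAt (Metric.isOpen_ball.mem_nhds hw)).differentiableAt (by norm_num)
  have hD := ((hasDerivAt_pow_mul_circleCoeff_dz hu 0 hs).sub
    (hasDerivAt_pow_mul_circleCoeff_dz hv 0 hs))
  have hD2 := (reCLM.hasFDerivAt.comp_hasDerivAt s hD).div_const 2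
  have hev : circleArea f =ᶠ[𝓝 s] fun x => reCLM ((x : ℂ) ^ (0 + 1) *
      circleCoeff 0 (fun w => f w * conj (dz f w)) ((0 : ℕ) + 1) x - (x : ℂ) ^ (0 + 1) *
      circleCoeff 0 (fun w => conj (f w) * dzbar f w) ((0 : ℕ) + 1) x) / 2 := by
    filter_upwards [isOpen_Ioo.mem_nhds (show s ∈ Ioo (-1 : ℝ) 1 from abs_lt.1 hs)] with x hx
    have hx' := abs_lt.2 hx
    have c1 : Continuous fun t : ℝ => conj (f (0 + x * exp (t * I)) *
        conj (dz f (0 + x * exp (t * I))) * exp (-(((0 : ℕ) + 1 : ℤ) * (t * I)))) :=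
      continuous_conj.comp ((continuous_on_circle hu.continuousOn hx').mul (by fun_prop))
    have c2 : Continuous fun t : ℝ => conj (f (0 + x * exp (t * I))) *
        dzbar f (0 + x * exp (t * I)) * exp (-(((0 : ℕ) + 1 : ℤ) * (t * I))) :=
      (continuous_on_circle hv.continuousOn hx').mul (by fun_prop)
    have e : ∫ t in (0 : ℝ)..(2 * Real.pi), conj (f (0 + x * exp (t * I))) *
        (I * x * (dz f (0 + x * exp (t * I)) * exp (t * I) -
          dzbar f (0 + x * exp (t * I)) * exp (-(t * I)))) =
        I * x * (conj (circleCoeff 0 (fun w => f w * conj (dz f w)) ((0 : ℕ) + 1) x) -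
          circleCoeff 0 (fun w => conj (f w) * dzbar f w) ((0 : ℕ) + 1) x) := by
      rw [circleCoeff, circleCoeff, ← intervalIntegral_conj,
        ← intervalIntegral.integral_sub (c1.intervalIntegrable _ _) (c2.intervalIntegrable _ _),
        ← intervalIntegral.integral_const_mul]
      refine intervalIntegral.integral_congr fun t _ => ?_
      have h1 : conj (exp (-(t * I))) = exp (t * I) := by
        rw [← conj_exp_mul_I, conj_conj]
      simp only [Nat.cast_zero, zero_add, Int.cast_one, one_mul, map_mul, conj_conj, h1]
      ring
    rw [circleArea, e]
    simp
    ring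
  refine (hD2.congr_of_eventuallyEq hev).congr_deriv ?_
  have k1 := continuous_on_circle (continuousOn_dz Metric.isOpen_ball hu) hs
  have k2 := continuous_on_circle (continuousOn_dz Metric.isOpen_ball hv) hs
  have k3 : Continuous fun t : ℝ => dz (fun w => f w * conj (dz f w)) (0 + s * exp (t * I)) -
        dz (fun w => conj (f w) * dzbar f w) (0 + s * exp (t * I)) := k1.sub k2
  have e : circleCoeff 0 (dz fun w => f w * conj (dz f w)) (0 : ℕ) s -
      circleCoeff 0 (dz fun w => conj (f w) * dzbar f w) (0 : ℕ) s =
      ∫ t in (0 : ℝ)..(2 * Real.pi), (dz (fun w => f w * conj (dz f w)) (0 + s * exp (t * I)) -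
        dz (fun w => conj (f w) * dzbar f w) (0 + s * exp (t * I))) := by
    rw [circleCoeff, circleCoeff, intervalIntegral.integral_sub (k1.intervalIntegrable _ _)
      (k2.intervalIntegrable _ _)]
    simp
  have e2 : ∫ t in (0 : ℝ)..(2 * Real.pi), jacobian f (0 + s * exp (t * I)) =
      reCLM (∫ t in (0 : ℝ)..(2 * Real.pi), (dz (fun w => f w * conj (dz f w))
        (0 + s * exp (t * I)) - dz (fun w => conj (f w) * dzbar f w) (0 + s * exp (t * I)))) := by
    rw [← reCLM.intervalIntegral_comp_comm (k3.intervalIntegrable _ _)]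
    refine intervalIntegral.integral_congr fun t _ => ?_
    have hm := mem_ball_circle (c := 0) hs t
    have hl := dzbar_dz (hf.contDiffAt (Metric.isOpen_ball.mem_nhds hm))
    rw [dz_mul (hdat hf1 _ hm) (hdat hzc _ hm), dz_mul (hdat hfc _ hm) (hdat hzb _ hm),
      dz_conj_comp, dz_conj_comp, hl.1, hl.2, mul_conj', conj_mul', jacobian, reCLM_apply]
    simp only [sub_re, add_re, ← ofReal_pow, ofReal_re, mul_re, conj_re, conj_im]
    ring
  rw [e2, ← e, reCLM_apply, reCLM_apply]
  simp only [sub_re, zero_add, pow_one]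
  rw [mul_assoc, mul_assoc, show (2 : ℂ) = ((2 : ℝ) : ℂ) by norm_num, re_ofReal_mul, re_ofReal_mul,
    re_ofReal_mul, re_ofReal_mul]
  ring

/-- The weighted energy estimate behind the gradient bound for the Poisson integral. -/
theorem norm_circleCoeff_mul_bergmanKernel_le {K : ℝ} (hf : ContDiffOn ℝ 2 f (Metric.ball 0 1))
    (hJ : ∀ w ∈ Metric.ball (0 : ℂ) 1, normD f w ^ 2 ≤ K * jacobian f w) {z : ℂ} (hz : ‖z‖ < 1)
    {l r : ℝ} (hl : 0 < l) (hr : 0 ≤ r) (hr1 : r < 1) :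
    r * (‖circleCoeff 0 (fun ζ => f ζ * bergmanKernel z ζ) 1 r‖ +
      ‖circleCoeff 0 (fun ζ => conj (f ζ) * bergmanKernel z ζ) 1 r‖) ≤
      l * K * circleArea f r + Real.pi * r ^ 2 / (1 - ‖z‖ ^ 2 * r ^ 2) ^ 2 / l := by
  have hf1 : ContDiffOn ℝ 1 f (Metric.ball 0 1) := hf.of_le (by norm_num)
  have hfc : ContDiffOn ℝ 1 (fun w => conj (f w)) (Metric.ball 0 1) :=
    contDiffOn_conj_comp (n := 1) hf1
  have hk := contDiffOn_bergmanKernel hz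
  have hu := hf1.mul hk
  have hv := hfc.mul hk
  have hcz := continuousOn_dz Metric.isOpen_ball hf1
  have hczb := continuousOn_dzbar Metric.isOpen_ball hf1
  have hdat : ∀ {v : ℂ → ℂ}, ContDiffOn ℝ 1 v (Metric.ball 0 1) → ∀ w ∈ Metric.ball (0 : ℂ) 1,
      DifferentiableAt ℝ v w := fun hv w hw =>
    (hv.contDiffAt (Metric.isOpen_ball.mem_nhds hw)).differentiableAt (by norm_num)
  set X := circleCoeff 0 (fun ζ => f ζ * bergmanKernel z ζ) 1 with hX
  set Y := circleCoeff 0 (fun ζ => conj (f ζ) * bergmanKernel z ζ) 1 with hY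
  -- Fixed unimodular factors, chosen at the final radius r, make the sum of the two norms the norm
  -- of one differentiable function of s.
  obtain ⟨α, hα, hαX⟩ := Complex.exists_norm_eq_mul_self (X r)
  obtain ⟨β, hβ, hβY⟩ := Complex.exists_norm_eq_mul_self (Y r)
  have hden : ∀ s : ℝ, |s| < 1 → 0 < 1 - ‖z‖ ^ 2 * s ^ 2 := fun s hs => by
    have h1 : ‖z‖ ^ 2 < 1 := pow_lt_one₀ (norm_nonneg _) hz two_ne_zero
    have h2 : s ^ 2 < 1 := by rw [← sq_abs]; exact pow_lt_one₀ (abs_nonneg _) hs two_ne_zero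
    nlinarith [sq_nonneg ‖z‖, sq_nonneg s]
  have key := norm_le_of_norm_deriv_le
    (W := fun s : ℝ => α * ((s : ℂ) ^ (0 + 1) * X s) + β * ((s : ℂ) ^ (0 + 1) * Y s))
    -- The last term is the antiderivative of s/l times the integral in
    -- `integral_norm_bergmanKernel_sq`.
    (B := fun s => l * K * circleArea f s + Real.pi * s ^ 2 / (1 - ‖z‖ ^ 2 * s ^ 2) ^ 2 / l)
    (B' := fun s => l * K * (s * ∫ t in (0 : ℝ)..(2 * Real.pi), jacobian f (0 + s * exp (t * I))) +
      s * (∫ t in (0 : ℝ)..(2 * Real.pi), ‖bergmanKernel z (0 + s * exp (t * I))‖ ^ 2) / l)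
    hr hr1
    (fun s hs => ((hasDerivAt_pow_mul_circleCoeff_dz hu 0 hs).const_mul α).add
      ((hasDerivAt_pow_mul_circleCoeff_dz hv 0 hs).const_mul β)) ?_ ?_ ?_
  · have e : α * ((r : ℂ) ^ (0 + 1) * X r) + β * ((r : ℂ) ^ (0 + 1) * Y r) =
        ((r * (‖X r‖ + ‖Y r‖) : ℝ) : ℂ) := by
      push_cast
      rw [hαX, hβY]
      ring
    simp only [e] at key
    rw [norm_real, Real.norm_of_nonneg (by positivity)] at key
    exact key
  · intro s hs
    refine ((hasDerivAt_circleArea hf hs).const_mul (l * K)).add ?_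
    refine HasDerivAt.div_const ?_ l
    rw [integral_norm_bergmanKernel_sq hz hs]
    have h0 := (hden s hs).ne'
    have h1 : HasDerivAt (fun s : ℝ => 1 - ‖z‖ ^ 2 * s ^ 2) (-(‖z‖ ^ 2 * (2 * s))) s := by
      simpa using ((hasDerivAt_pow 2 s).const_mul (‖z‖ ^ 2)).const_sub 1
    refine (((hasDerivAt_pow 2 s).const_mul Real.pi).div (h1.pow 2) (pow_ne_zero 2 h0)).congr_deriv ?_
    simp
    field_simp
    ring
  · simp [circleArea]
  · intro s hs0 hs1
    have hs : |s| < 1 := by rwa [abs_of_nonneg hs0]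
    have hkc := continuous_on_circle hk.continuousOn hs
    have hzc := continuous_on_circle hcz hs
    have hzbc := continuous_on_circle hczb hs
    have hb : ∀ v : ℂ → ℂ, ContDiffOn ℝ 1 v (Metric.ball 0 1) →
        ‖circleCoeff 0 (dz fun w => v w * bergmanKernel z w) (0 : ℕ) s‖ ≤
        ∫ t in (0 : ℝ)..(2 * Real.pi), ‖dz v (0 + s * exp (t * I))‖ *
          ‖bergmanKernel z (0 + s * exp (t * I))‖ := fun v hv => by
      refine (norm_circleCoeff_le_integral _ _ _ _).trans_eq ?_
      refine intervalIntegral.integral_congr fun t _ => ?_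
      have hm := mem_ball_circle (c := 0) hs t
      rw [dz_mul (hdat hv _ hm) (hdat hk _ hm), dz_bergmanKernel hz (by simpa using hm), mul_zero,
        add_zero, norm_mul]
    have b1 := hb f hf1
    have b2 := hb _ hfc
    simp only [dz_conj_comp, RCLike.norm_conj] at b2
    have hsum : (∫ t in (0 : ℝ)..(2 * Real.pi), ‖dz f (0 + s * exp (t * I))‖ *
          ‖bergmanKernel z (0 + s * exp (t * I))‖) +
        (∫ t in (0 : ℝ)..(2 * Real.pi), ‖dzbar f (0 + s * exp (t * I))‖ *
          ‖bergmanKernel z (0 + s * exp (t * I))‖) ≤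
        (l * K * (∫ t in (0 : ℝ)..(2 * Real.pi), jacobian f (0 + s * exp (t * I))) +
        (∫ t in (0 : ℝ)..(2 * Real.pi), ‖bergmanKernel z (0 + s * exp (t * I))‖ ^ 2) / l) / 2 := by
      have cj : Continuous fun t : ℝ => jacobian f (0 + s * exp (t * I)) := by
        unfold jacobian; fun_prop
      rw [← intervalIntegral.integral_add (Continuous.intervalIntegrable (by fun_prop) _ _)
        (Continuous.intervalIntegrable (by fun_prop) _ _), ← intervalIntegral.integral_const_mul,
        ← intervalIntegral.integral_div, ← intervalIntegral.integral_add
        (Continuous.intervalIntegrable (by fun_prop) _ _)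
        (Continuous.intervalIntegrable (by fun_prop) _ _), ← intervalIntegral.integral_div]
      refine intervalIntegral.integral_mono_on Real.two_pi_pos.le
        (Continuous.intervalIntegrable (by fun_prop) _ _)
        (Continuous.intervalIntegrable (by fun_prop) _ _) fun t _ => ?_
      have h1 := mul_le_mul_of_nonneg_left (hJ _ (mem_ball_circle (c := 0) hs t)) hl.le
      set A := normD f (0 + s * exp (t * I)) with hA
      set B := ‖bergmanKernel z (0 + s * exp (t * I))‖
      rw [← add_mul]
      change A * B ≤ _
      -- AM-GM with weight l: 2AB ≤ lA² + B²/l, where A² ≤ K J_f.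
      have h2 : 0 ≤ l * (A - B / l) ^ 2 := by positivity
      have h3 : l * (A - B / l) ^ 2 = l * A ^ 2 - 2 * (A * B) + B ^ 2 / l := by
        field_simp
        ring
      linarith
    refine (norm_add_le _ _).trans ?_
    simp only [norm_mul, hα, hβ, one_mul, norm_real, Real.norm_of_nonneg hs0,
      Complex.norm_ofNat, Nat.zero_add, pow_one]
    have hs2 : 0 ≤ 2 * s := by positivity
    have g1 := mul_le_mul_of_nonneg_left b1 hs2
    have g2 := mul_le_mul_of_nonneg_left b2 hs2
    have g3 := mul_le_mul_of_nonneg_left hsum hs2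
    refine (add_le_add g1 g2).trans ?_
    rw [← mul_add]
    refine g3.trans_eq ?_
    generalize (∫ t in (0 : ℝ)..(2 * Real.pi), jacobian f (0 + s * exp (t * I))) = J
    generalize (∫ t in (0 : ℝ)..(2 * Real.pi), ‖bergmanKernel z (0 + s * exp (t * I))‖ ^ 2) = N
    ring

end Area

/-! ### Bounds for quasiconformal solutions. -/

theorem norm_le_supNorm {g : ℂ → ℂ} (hg : ContinuousOn g closedDisk) {z : ℂ}
    (hz : z ∈ closedDisk) : ‖g z‖ ≤ supNorm g :=
  le_csSup ((isCompact_closedBall (0 : ℂ) 1).bddAbove_image hg.norm) (mem_image_of_mem _ hz)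

theorem supNorm_nonneg (g : ℂ → ℂ) : 0 ≤ supNorm g := by
  refine Real.sSup_nonneg ?_
  rintro _ ⟨z, -, rfl⟩
  exact norm_nonneg _

theorem perimeter_nonneg (f : ℂ → ℂ) {r : ℝ} (hr : 0 ≤ r) : 0 ≤ perimeter f r :=
  mul_nonneg hr (intervalIntegral.integral_nonneg Real.two_pi_pos.le fun _ _ => norm_nonneg _)

theorem boundaryPerimeter_nonneg (f : ℂ → ℂ) : 0 ≤ boundaryPerimeter f := by
  refine Real.sSup_nonneg ?_
  rintro _ ⟨r, hr, rfl⟩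
  exact perimeter_nonneg f hr.1.le

theorem perimeter_le_boundaryPerimeter {f : ℂ → ℂ} (h : HasFiniteBoundaryPerimeter f) {r : ℝ}
    (hr : r ∈ Ioo (0 : ℝ) 1) : perimeter f r ≤ boundaryPerimeter f :=
  le_csSup h (mem_image_of_mem _ hr)

theorem normD_nonneg (f : ℂ → ℂ) (z : ℂ) : 0 ≤ normD f z :=
  add_nonneg (norm_nonneg _) (norm_nonneg _)

theorem closedDisk_supset_disk : disk ⊆ closedDisk := Metric.ball_subset_closedBall

theorem IsQuasiconformalOn.normD_sq_le {K : ℝ} {f : ℂ → ℂ} (h : IsQuasiconformalOn K f disk) {w : ℂ}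
    (hw : w ∈ disk) : normD f w ^ 2 ≤ K * jacobian f w := by
  have hd : DifferentiableAt ℝ f w :=
    (h.contDiffOn.contDiffAt (Metric.isOpen_ball.mem_nhds hw)).differentiableAt (by norm_num)
  have h1 := h.distortion w hw
  rwa [abs_of_nonneg (h.sensePreserving.jacobian_nonneg hw hd)] at h1

/-- J_f factors as ‖D_f‖(|f_z| - |f_z̄|), so one factor ‖D_f‖ cancels unless it is zero. With c =
e^(-2it) the right side is K times the perimeter integrand. -/
theorem normD_le_of_sq_le {K : ℝ} {f : ℂ → ℂ} {w c : ℂ} (hK : 0 ≤ K)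
    (h : normD f w ^ 2 ≤ K * jacobian f w) (hc : ‖c‖ = 1) :
    normD f w ≤ K * ‖dz f w - c * dzbar f w‖ := by
  have h1 : ‖dz f w‖ - ‖dzbar f w‖ ≤ ‖dz f w - c * dzbar f w‖ := by
    have := norm_sub_norm_le (dz f w) (c * dzbar f w)
    rwa [norm_mul, hc, one_mul] at this
  refine le_trans ?_ (mul_le_mul_of_nonneg_left h1 hK)
  rcases (normD_nonneg f w).eq_or_lt with h0 | h0
  · have h2 : ‖dz f w‖ = 0 ∧ ‖dzbar f w‖ = 0 := by
      have ha := norm_nonneg (dz f w)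
      have hb := norm_nonneg (dzbar f w)
      rw [normD] at h0
      constructor <;> linarith
    rw [normD, h2.1, h2.2]
    simp
  · have h2 : normD f w * normD f w ≤ normD f w * (K * (‖dz f w‖ - ‖dzbar f w‖)) := by
      have e : normD f w * (K * (‖dz f w‖ - ‖dzbar f w‖)) = K * jacobian f w := by
        rw [normD, jacobian]; ring
      rw [e, ← sq]
      exact h
    exact le_of_mul_le_mul_left h2 h0

section Main

variable {K : ℝ} {g f : ℂ → ℂ}

theorem IsPoissonSolution.norm_laplacian_le (hg : ContinuousOn g closedDisk)
    (hf : IsPoissonSolution g f) {z : ℂ} (hz : z ∈ disk) :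
    ‖Laplacian.laplacian f z‖ ≤ supNorm g := by
  rw [hf.laplacian_eq z hz]
  exact norm_le_supNorm hg (closedDisk_supset_disk hz)

theorem integral_normD_le (hf : IsPoissonSolution g f) (hq : IsQuasiconformalOn K f disk) {s : ℝ}
    (hs : 0 ≤ s) (hs1 : s < 1) :
    s * ((∫ t in (0 : ℝ)..(2 * Real.pi), ‖dz f (0 + s * exp (t * I))‖) +
      ∫ t in (0 : ℝ)..(2 * Real.pi), ‖dzbar f (0 + s * exp (t * I))‖) ≤ K * perimeter f s := by
  have hsa : |s| < 1 := by rwa [abs_of_nonneg hs]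
  have hf1 : ContDiffOn ℝ 1 f (Metric.ball 0 1) := hf.contDiffOn.of_le (by norm_num)
  have h1 := continuous_on_circle (continuousOn_dz Metric.isOpen_ball hf1) hsa
  have h2 := continuous_on_circle (continuousOn_dzbar Metric.isOpen_ball hf1) hsa
  have h1' : Continuous fun t : ℝ => dz f (s * exp (t * I)) := by simpa using h1
  have h2' : Continuous fun t : ℝ => dzbar f (s * exp (t * I)) := by simpa using h2
  rw [← intervalIntegral.integral_add (Continuous.intervalIntegrable (by fun_prop) _ _)
    (Continuous.intervalIntegrable (by fun_prop) _ _), perimeter, mul_left_comm]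
  refine mul_le_mul_of_nonneg_left ?_ hs
  rw [← intervalIntegral.integral_const_mul]
  refine intervalIntegral.integral_mono_on Real.two_pi_pos.le
    (Continuous.intervalIntegrable (by fun_prop) _ _)
    (Continuous.intervalIntegrable (by fun_prop) _ _) fun t _ => ?_
  rw [zero_add]
  have hm : (s * exp (t * I) : ℂ) ∈ disk := by
    have := mem_ball_circle (c := 0) hsa t
    rwa [zero_add] at this
  refine normD_le_of_sq_le (zero_le_one.trans hq.one_le) (hq.normD_sq_le hm) ?_
  rw [show -(2 * (t : ℂ) * I) = ((-(2 * t) : ℝ) : ℂ) * I by push_cast; ring]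
  exact norm_exp_ofReal_mul_I _

theorem continuousOn_conj_comp {s : Set ℂ} (hf : ContinuousOn f s) :
    ContinuousOn (fun w => conj (f w)) s := continuous_conj.comp_continuousOn hf

/-- Bound for the boundary Fourier coefficients of a quasiconformal solution. -/
theorem mul_norm_boundary_circleCoeff_le (hg : ContinuousOn g closedDisk)
    (hf : IsPoissonSolution g f) (hq : IsQuasiconformalOn K f disk)
    (hp : HasFiniteBoundaryPerimeter f) {n : ℕ} (hn : 1 ≤ n) :
    n * (‖circleCoeff 0 f n 1‖ + ‖circleCoeff 0 (fun w => conj (f w)) n 1‖) ≤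
      K * boundaryPerimeter f + 2 * Real.pi * supNorm g / 3 := by
  have hM0 := supNorm_nonneg g
  have hlim := ((tendsto_circleCoeff hf.continuousOn n).norm.add
    (tendsto_circleCoeff (continuousOn_conj_comp hf.continuousOn) n).norm).const_mul (n : ℝ)
  refine le_of_tendsto hlim ?_
  filter_upwards [Ioo_mem_nhdsLT (zero_lt_one' ℝ)] with s hs
  have h1 := mul_norm_circleCoeff_le hf.contDiffOn (fun z hz => hf.norm_laplacian_le hg hz) n
    hs.1 hs.2
  have h2 := mul_norm_circleCoeff_le (f := fun w => conj (f w))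
    (contDiffOn_conj_comp (n := 2) hf.contDiffOn) (fun z hz => by
      rw [norm_laplacian_conj_comp]; exact hf.norm_laplacian_le hg hz) n hs.1 hs.2
  simp only [dz_conj_comp, RCLike.norm_conj] at h2
  have h3 := integral_normD_le hf hq hs.1.le hs.2
  have h4 := mul_le_mul_of_nonneg_left (perimeter_le_boundaryPerimeter hp hs)
    (zero_le_one.trans hq.one_le)
  -- For n ≥ 1 the denominator is at least 3; the bound is spent twice, for f and for its conjugate.
  have h5 : s * (Real.pi * supNorm g * s / (n + 2)) ≤ Real.pi * supNorm g / 3 := by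
    have hn' : (1 : ℝ) ≤ n := by exact_mod_cast hn
    have h6 : 0 ≤ Real.pi * supNorm g := by positivity
    have h7 : s * s ≤ 1 := by nlinarith [hs.1, hs.2]
    rw [← mul_div_assoc]
    refine div_le_div₀ h6 ?_ (by norm_num) (by linarith)
    nlinarith
  rw [mul_add]
  linarith

/-- The square of this bound is the first of the three terms under the root in (ii). -/
theorem normD_poissonIntegral_mul_le (hf : IsPoissonSolution g f)
    (hq : IsQuasiconformalOn K f disk) (hp : HasFiniteBoundaryPerimeter f) {z : ℂ}
    (hz : z ∈ disk) :
    normD (poissonIntegral f) z * (1 - ‖z‖ ^ 2) ≤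
      boundaryPerimeter f * Real.sqrt K / (2 * Real.pi) := by
  have hz : ‖z‖ < 1 := by simpa [disk] using hz
  have hK : 0 ≤ K := zero_le_one.trans hq.one_le
  have hℓ := boundaryPerimeter_nonneg f
  set ℓ := boundaryPerimeter f
  have hx : ‖z‖ ^ 2 < 1 := pow_lt_one₀ (norm_nonneg _) hz two_ne_zero
  have hpi := Real.pi_pos
  set N := 1 - ‖z‖ ^ 2 with hN
  have hN0 : 0 < N := by rw [hN]; linarith
  have hkc := continuousOn_bergmanKernel hz
  have hbound : ∀ l : ℝ, 0 < l →
      ‖circleCoeff 0 (fun ζ => f ζ * bergmanKernel z ζ) 1 1‖ +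
        ‖circleCoeff 0 (fun ζ => conj (f ζ) * bergmanKernel z ζ) 1 1‖ ≤
      l * K * (ℓ ^ 2 / (4 * Real.pi)) + Real.pi / N ^ 2 / l := by
    intro l hl
    have hid : Tendsto (fun r : ℝ => r) (𝓝[<] 1) (𝓝 1) := nhdsWithin_le_nhds
    have hlim := hid.mul ((tendsto_circleCoeff (hf.continuousOn.mul hkc) 1).norm.add
      (tendsto_circleCoeff ((continuousOn_conj_comp hf.continuousOn).mul hkc) 1).norm)
    rw [one_mul] at hlim
    refine le_of_tendsto hlim ?_
    filter_upwards [Ioo_mem_nhdsLT (zero_lt_one' ℝ)] with r hr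
    refine (norm_circleCoeff_mul_bergmanKernel_le hf.contDiffOn
      (fun w hw => hq.normD_sq_le hw) hz hl hr.1.le hr.2).trans (add_le_add ?_ ?_)
    · refine mul_le_mul_of_nonneg_left ?_ (by positivity)
      refine (circleArea_le (hf.contDiffOn.of_le (by norm_num)) hr.1.le hr.2).trans ?_
      have := pow_le_pow_left₀ (perimeter_nonneg f hr.1.le) (perimeter_le_boundaryPerimeter hp hr) 2
      gcongr
    · have h1 : r ^ 2 ≤ 1 := pow_le_one₀ hr.1.le hr.2.le
      have h2 : N ≤ 1 - ‖z‖ ^ 2 * r ^ 2 := by rw [hN]; nlinarith [sq_nonneg ‖z‖]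
      gcongr
      nlinarith
  rw [normD_poissonIntegral hf.continuousOn hz]
  set A := ‖circleCoeff 0 (fun ζ => f ζ * bergmanKernel z ζ) 1 1‖ +
        ‖circleCoeff 0 (fun ζ => conj (f ζ) * bergmanKernel z ζ) 1 1‖
  have hs := Real.sqrt_nonneg K
  have ha : 0 ≤ ℓ * Real.sqrt K / (2 * Real.pi) := by positivity
  have ha2 : (ℓ * Real.sqrt K / (2 * Real.pi)) ^ 2 * Real.pi = K * (ℓ ^ 2 / (4 * Real.pi)) := by
    rw [div_pow, mul_pow, Real.sq_sqrt hK]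
    field_simp
    ring
  set a := ℓ * Real.sqrt K / (2 * Real.pi)
  -- The optimal weight is 1/(aN); replacing a by a + ε keeps it meaningful when a = 0.
  refine le_of_forall_pos_le_add fun ε hε => ?_
  have haε : 0 < a + ε := by linarith
  have h := hbound (1 / ((a + ε) * N)) (by positivity)
  rw [mul_assoc, ← ha2] at h
  have h1 : 1 / ((a + ε) * N) * (a ^ 2 * Real.pi) ≤ Real.pi * (a + ε) / N := by
    rw [div_mul_eq_mul_div, one_mul, div_le_div_iff₀ (by positivity) hN0]
    have : a ^ 2 ≤ (a + ε) ^ 2 := by nlinarith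
    nlinarith [mul_le_mul_of_nonneg_left this (mul_nonneg hpi.le hN0.le)]
  have h2 : Real.pi / N ^ 2 / (1 / ((a + ε) * N)) = Real.pi * (a + ε) / N := by
    field_simp
  rw [h2] at h
  have h3 : A ≤ 2 * Real.pi * (a + ε) / N := by
    refine (h.trans (add_le_add_left h1 _)).trans_eq ?_
    ring
  rw [le_div_iff₀ hN0] at h3
  have h4 : 1 / (2 * Real.pi) * A * N = A * N / (2 * Real.pi) := by ring
  rw [h4, div_le_iff₀ Real.two_pi_pos]
  linarith

theorem distBoundary_le {z : ℂ} (hz : z ∈ disk) : distBoundary z ≤ 1 - ‖z‖ := by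
  have hz1 : ‖z‖ < 1 := by simpa [disk] using hz
  have hfr : frontier disk = Metric.sphere (0 : ℂ) 1 := frontier_ball 0 one_ne_zero
  rw [distBoundary, hfr]
  by_cases h0 : z = 0
  · subst h0
    refine (Metric.infDist_le_dist_of_mem (y := (1 : ℂ)) (by simp)).trans ?_
    simp
  · have hn : ‖z‖ ≠ 0 := norm_ne_zero_iff.2 h0
    refine (Metric.infDist_le_dist_of_mem (y := ((‖z‖⁻¹ : ℝ) : ℂ) * z) ?_).trans ?_
    · simp [hn]
    · rw [dist_eq, show z - ((‖z‖⁻¹ : ℝ) : ℂ) * z = ((1 - ‖z‖⁻¹ : ℝ) : ℂ) * z by push_cast; ring,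
        norm_mul, norm_real, Real.norm_eq_abs, abs_sub_comm,
        abs_of_nonneg (sub_nonneg.2 ((one_le_inv₀ (norm_pos_iff.2 h0)).2 hz1.le)), sub_mul,
        inv_mul_cancel₀ hn, one_mul]

theorem IsPoissonSolution.isBlochType (hg : ContinuousOn g closedDisk)
    (hf : IsPoissonSolution g f) : IsBlochType (fun t => t) 1 f := by
  refine ⟨⟨continuousOn_id, monotone_id.monotoneOn _, rfl, ?_⟩, one_pos,
    hf.contDiffOn.of_le (by norm_num), ?_⟩
  · intro x hx y hy _
    have hx' : x ≠ 0 := ne_of_gt hx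
    have hy' : y ≠ 0 := ne_of_gt hy
    simp [hx', hy']
  · refine ⟨4 * (supNorm f + supNorm g), ?_⟩
    rintro _ ⟨z, hz, rfl⟩
    have hz1 : ‖z‖ < 1 := by simpa [disk] using hz
    have hR : 0 < 1 - ‖z‖ := by linarith
    have hsub : Metric.ball z (1 - ‖z‖) ⊆ disk := Metric.ball_subset_ball' (by simp)
    -- The interior estimate at half the distance 1 - |z|; halving the radius doubles the factor 2,
    -- whence the constant 4.
    have h1 := normD_center_le (c := z) (R := 1 - ‖z‖) (hf.contDiffOn.mono hsub)
      (fun w hw => hf.norm_laplacian_le hg (hsub hw))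
      (fun w hw => norm_le_supNorm hf.continuousOn (closedDisk_supset_disk (hsub hw)))
      (half_pos hR) (half_lt_self hR)
    have h2 := mul_le_mul_of_nonneg_left (distBoundary_le hz) (normD_nonneg f z)
    have h3 : ((1 - ‖z‖) / 2) ^ 2 ≤ 1 := by nlinarith [norm_nonneg z]
    have h4 := mul_le_mul_of_nonneg_left h3 (supNorm_nonneg g)
    simp only [Real.rpow_one]
    linarith

end Main

/-! ### The extremal function f(z) = z. -/

section Identity

theorem dz_id (z : ℂ) : dz (fun w => w) z = 1 := dz_of_hasDerivAt (hasDerivAt_id z)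

theorem dzbar_id (z : ℂ) : dzbar (fun w => w) z = 0 := dzbar_of_hasDerivAt (hasDerivAt_id z)

theorem perimeter_id (r : ℝ) : perimeter (fun w => w) r = r * (2 * Real.pi) := by
  simp [perimeter, dz_id, dzbar_id]

theorem hasFiniteBoundaryPerimeter_id : HasFiniteBoundaryPerimeter fun z => z := by
  refine ⟨2 * Real.pi, ?_⟩
  rintro _ ⟨r, hr, rfl⟩
  rw [perimeter_id]
  exact mul_le_of_le_one_left Real.two_pi_pos.le hr.2.le

theorem boundaryPerimeter_id : boundaryPerimeter (fun z => z) = 2 * Real.pi := by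
  have h : perimeter (fun z => z) '' Ioo 0 1 = Ioo 0 (2 * Real.pi) := by
    rw [show perimeter (fun z => z) = fun r => r * (2 * Real.pi) from funext perimeter_id,
      image_mul_right_Ioo _ _ Real.two_pi_pos]
    simp
  rw [boundaryPerimeter, h, csSup_Ioo Real.two_pi_pos]

theorem circleCoeff_id (n : ℕ) :
    circleCoeff 0 (fun z => z) n 1 = (if n = 1 then 2 * Real.pi else 0 : ℂ) := by
  have h := integral_exp_neg_int (n - 1)
  rw [circleCoeff]
  simp only [zero_add, ofReal_one, one_mul, exp_mul_exp_neg]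
  rw [h]
  have : ((n : ℤ) - 1 = 0) ↔ n = 1 := by omega
  simp only [this]

theorem circleCoeff_conj_id (n : ℕ) : circleCoeff 0 (fun z => conj z) n 1 = 0 := by
  have h := integral_exp_neg_int (n + 1)
  rw [circleCoeff]
  simp only [zero_add, ofReal_one, one_mul, conj_exp_mul_I, exp_neg_mul_exp_neg]
  rw [h, if_neg (by omega)]

theorem poissonIntegral_id {z : ℂ} (hz : z ∈ disk) : poissonIntegral (fun z => z) z = z := by
  obtain ⟨s, t, hs, ht, h⟩ := hasHarmonicExpansion_poissonIntegral (f := fun z => z)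
    (by fun_prop) z hz
  have hp : (Real.pi : ℂ) ≠ 0 := by exact_mod_cast Real.pi_ne_zero
  have hs' : s = z := by
    refine hs.unique ?_
    convert hasSum_single 1 ?_ using 1
    · simp only [circleCoeff_id, if_true, pow_one]
      field_simp
    · intro k hk
      simp [circleCoeff_id, hk]
  have ht' : t = 0 := by
    refine ht.unique ?_
    convert hasSum_zero using 2 with n
    have := circleCoeff_conj_id (n + 1)
    push_cast at this
    simp [this]
  rw [h, hs', ht', add_zero]

theorem isPoissonSolution_id : IsPoissonSolution (fun _ => 0) fun z => z := by
  refine ⟨continuousOn_id, contDiffOn_id, fun z _ => ?_⟩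
  have h := (dzbar_dz (f := fun z => z) (z := z) contDiffAt_id).1
  rw [show dz (fun z => z) = fun _ => (1 : ℂ) from funext dz_id,
    dzbar_of_hasDerivAt (hasDerivAt_const z (1 : ℂ))] at h
  simpa using h.symm

theorem isQuasiconformalOn_id : IsQuasiconformalOn 1 (fun z => z) disk := by
  refine ⟨le_rfl, contDiffOn_id, ?_, ?_, ?_⟩
  · exact Metric.isOpen_ball.isOpenEmbedding_subtypeVal
  · intro z _
    filter_upwards [self_mem_nhdsWithin] with r hr
    have hr0 : (r : ℂ) ≠ 0 := by exact_mod_cast (ne_of_gt hr)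
    refine ⟨fun t => log r + t * I, by fun_prop, fun t => ?_, ?_⟩
    · rw [exp_add, exp_log hr0, add_sub_cancel_left]
    · push_cast
      simp
  · intro z _
    simp [normD, jacobian, dz_id, dzbar_id]

theorem supNorm_zero : supNorm (fun _ => 0) = 0 := by
  have h : (fun _ : ℂ => ‖(0 : ℂ)‖) '' closedDisk = {0} := by
    rw [norm_zero]
    exact Nonempty.image_const ⟨0, by simp [closedDisk]⟩ _
  rw [supNorm, h, csSup_singleton]

theorem norm_coeff_add_id {a b : ℕ → ℂ}
    (h : HasHarmonicExpansion (poissonIntegral fun z => z) a b) : ‖a 1‖ + ‖b 1‖ = 1 := by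
  have hu := h.unique (hasHarmonicExpansion_poissonIntegral (f := fun z => z) (by fun_prop))
    (le_refl 1)
  have hp : (Real.pi : ℂ) ≠ 0 := by exact_mod_cast Real.pi_ne_zero
  have h1 : (1 / (2 * Real.pi) : ℂ) * (2 * Real.pi) = 1 := by field_simp
  rw [hu.1, hu.2]
  simp only [circleCoeff_id, circleCoeff_conj_id, if_true, h1, mul_zero, norm_one, norm_zero,
    add_zero]

theorem isLUB_normD_poissonIntegral_id :
    IsLUB ((fun z => normD (poissonIntegral fun z => z) z * (1 - ‖z‖ ^ 2)) '' disk) 1 := by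
  have h : ∀ z ∈ disk, normD (poissonIntegral fun z => z) z = 1 := fun z hz => by
    have hev : poissonIntegral (fun z => z) =ᶠ[𝓝 z] fun z => z := by
      filter_upwards [Metric.isOpen_ball.mem_nhds hz] with w hw using poissonIntegral_id hw
    have h1 := dz_id z
    have h2 := dzbar_id z
    rw [dz, ← hev.fderiv_eq, ← dz] at h1
    rw [dzbar, ← hev.fderiv_eq, ← dzbar] at h2
    rw [normD, h1, h2]
    simp
  -- P[f] is the identity, so the quantity is 1 - |z|², with maximum at the origin.
  refine IsGreatest.isLUB ⟨⟨0, by simp [disk], ?_⟩, ?_⟩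
  · simp only
    rw [h 0 (by simp [disk])]
    simp
  · rintro _ ⟨z, hz, rfl⟩
    simp only
    rw [h z hz]
    nlinarith [sq_nonneg ‖z‖]

end Identity

end PoissonDisk

end

/-! ### Assembly. -/

theorem theorem3 :
    (∀ (K : ℝ) (g f : ℂ → ℂ), ContinuousOn g closedDisk → IsPoissonSolution g f →
      (∀ z ∈ disk, f z = poissonIntegral f z - greenPotential g z) →
      IsQuasiconformalOn K f disk → HasFiniteBoundaryPerimeter f →
      (∃ a b : ℕ → ℂ, HasHarmonicExpansion (poissonIntegral f) a b) ∧
      (∀ a b : ℕ → ℂ, HasHarmonicExpansion (poissonIntegral f) a b → ∀ n : ℕ, 1 ≤ n →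
        ‖a n‖ + ‖b n‖ ≤
          K * boundaryPerimeter f / (2 * n * Real.pi) + 2 / (3 * n) * supNorm g) ∧
      (∀ z ∈ disk, normD (poissonIntegral f) z * (1 - ‖z‖ ^ 2) ≤
        Real.sqrt (boundaryPerimeter f ^ 2 * K / (4 * Real.pi ^ 2) + 4 / 9 * supNorm g ^ 2
          + boundaryPerimeter f * Real.sqrt K / (3 * Real.pi) * supNorm g)) ∧
      IsBlochType (fun t => t) 1 f) ∧
    -- sharpness for `K = 1`, `g = 0`, with extremal function `f(z) = z`
    (IsPoissonSolution (fun _ => 0) (fun z => z) ∧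
      (∀ z ∈ disk, z = poissonIntegral (fun z => z) z - greenPotential (fun _ => 0) z) ∧
      IsQuasiconformalOn 1 (fun z => z) disk ∧
      HasFiniteBoundaryPerimeter (fun z => z) ∧
      supNorm (fun _ => 0) = 0 ∧
      (∀ a b : ℕ → ℂ, HasHarmonicExpansion (poissonIntegral (fun z => z)) a b →
        ‖a 1‖ + ‖b 1‖ = boundaryPerimeter (fun z => z) / (2 * Real.pi)) ∧
      IsLUB ((fun z => normD (poissonIntegral (fun z => z)) z * (1 - ‖z‖ ^ 2)) '' disk)
        (Real.sqrt (boundaryPerimeter (fun z => z) ^ 2 / (4 * Real.pi ^ 2)))) := by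
  refine ⟨fun K g f hg hf _ hq hp => ⟨⟨_, _, hasHarmonicExpansion_poissonIntegral
    (continuous_boundary hf.continuousOn)⟩, fun a b hab n hn => ?_, fun z hz => ?_,
    hf.isBlochType hg⟩, isPoissonSolution_id, fun z hz => ?_, isQuasiconformalOn_id,
    hasFiniteBoundaryPerimeter_id, supNorm_zero, fun a b hab => ?_, ?_⟩
  · obtain ⟨h1, h2⟩ := hab.unique (hasHarmonicExpansion_poissonIntegral
      (continuous_boundary hf.continuousOn)) hn
    have h3 := mul_norm_boundary_circleCoeff_le hg hf hq hp hn
    have hn0 : (0 : ℝ) < n := by exact_mod_cast hn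
    have hpi := Real.pi_pos
    have hM := supNorm_nonneg g
    have e : ‖(1 / (2 * Real.pi) : ℂ)‖ = 1 / (2 * Real.pi) := by
      simp [abs_of_pos hpi]
    rw [h1, h2, norm_mul, norm_mul, e, ← mul_add]
    -- The estimate obtained has ‖g‖/(3n) in place of 2‖g‖/(3n), hence 4π/3 here against 2π/3 in
    -- `h3`.
    have h4 : K * boundaryPerimeter f / (2 * n * Real.pi) + 2 / (3 * n) * supNorm g =
        (K * boundaryPerimeter f + 4 * Real.pi * supNorm g / 3) / n * (1 / (2 * Real.pi)) := by
      field_simp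
      ring
    rw [h4, mul_comm]
    refine mul_le_mul_of_nonneg_right ?_ (by positivity)
    rw [le_div_iff₀ hn0, mul_comm]
    have : 0 ≤ Real.pi * supNorm g := by positivity
    linarith
  · refine (normD_poissonIntegral_mul_le hf hq hp hz).trans (Real.le_sqrt_of_sq_le ?_)
    have hK : 0 ≤ K := zero_le_one.trans hq.one_le
    have hpi := Real.pi_pos
    have hM := supNorm_nonneg g
    have hℓ := boundaryPerimeter_nonneg f
    have hs := Real.sqrt_nonneg K
    have e : (boundaryPerimeter f * Real.sqrt K / (2 * Real.pi)) ^ 2 =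
        boundaryPerimeter f ^ 2 * K / (4 * Real.pi ^ 2) := by
      rw [div_pow, mul_pow, Real.sq_sqrt hK]
      ring
    rw [e, add_assoc]
    -- The two terms containing ‖g‖ are nonnegative and only enlarge the bound.
    exact le_add_of_nonneg_right (by positivity)
  · rw [poissonIntegral_id hz]
    simp [greenPotential]
  · rw [norm_coeff_add_id hab, boundaryPerimeter_id, div_self Real.two_pi_pos.ne']
  · have e : boundaryPerimeter (fun z => z) ^ 2 / (4 * Real.pi ^ 2) = 1 := by
      rw [boundaryPerimeter_id, mul_pow]
      have := Real.pi_pos.ne'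
      field_simp
      norm_num
    rw [e, Real.sqrt_one]
    exact isLUB_normD_poissonIntegral_id
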